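/- **Corollary (controllability of the nonselective two-spin Ising system).** Let $\lambda_0=\tfrac1{\sqrt2}\begin{pmatrix}1&0\\0&1\end{pmatrix}$, $\lambda_1=\tfrac1{\sqrt2}\begin{pmatrix}0&1\\1&0\end{pmatrix}$, $\lambda_2=\tfrac1{\sqrt2}\begin{pmatrix}0&-i\\i&0\end{pmatrix}$, $\lambda_3=\tfrac1{\sqrt2}\begin{pmatrix}1&0\\0&-1\end{pmatrix}$ be the normalized Pauli matrices and $\Lambda_{jk}=\lambda_j\otimes\lambda_k$. For $h^{03},h^{30},h^{33}\in\mathbb R$ let $$H_{\rm f}=h^{03}\Lambda_{03}+h^{30}\Lambda_{30}+h^{33}\Lambda_{33},\qquad H_{\rm c,ns}=\Lambda_{01}+\Lambda_{10}.$$ Assume $h^{03}\neq0$, $h^{30}\neq 0$ and $h^{03}\neq-h^{30}$ (for instance $h^{03},h^{30}>0$). If $h^{03}\neq h^{30}$, $h^{33}\neq0$ and $h^{33}\neq\pm(h^{03}-h^{30})/2$, then the control system with Hamiltonian $H_{\rm f}+uH_{\rm c,ns}$ is controllable by smooth real controls $u\in C^\infty(\mathbb R)$, that is: 1. for all $U,V\in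 SU(4)$ there are $T>0$, $u\in C^\infty(\mathbb R)$ and a solution $X$ of $\dot X=-i\,(H_{\rm f}+u(t)H_{\rm c,ns})X$ on $[0,T]$ with $X(0)=U$ and $X(T)=V$; 2. for all $4\times4$ density matrices $\rho_0,\rho_1$ (positive semidefinite, trace one) that are unitarily equivalent, there are $T>0$, $u\in C^\infty(\mathbb R)$ and a solution $\rho$ of the Liouville–von Neumann equation $\dot\rho=-i\,[H_{\rm f}+u(t)H_{\rm c,ns},\rho]$ on $[0,T]$ with $\rho(0)=\rho_0$ and $\rho(T)=\rho_1$. -/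

import Mathlib

open scoped Kronecker Matrix ContDiff ComplexOrder

noncomputable section

namespace SpinControl

/-- The normalized Pauli matrices `λ₀, λ₁, λ₂, λ₃`, with `λ₀ = 1 / √2` and
`tr (λⱼ λₖ) = δⱼₖ`. -/
def pauli : Fin 4 → Matrix (Fin 2) (Fin 2) ℂ :=
  ![((Real.sqrt 2 : ℝ) : ℂ)⁻¹ • !![1, 0; 0, 1],
    ((Real.sqrt 2 : ℝ) : ℂ)⁻¹ • !![0, 1; 1, 0],
    ((Real.sqrt 2 : ℝ) : ℂ)⁻¹ • !![0, -Complex.I; Complex.I, 0],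
    ((Real.sqrt 2 : ℝ) : ℂ)⁻¹ • !![1, 0; 0, -1]]

/-- The product operators `Λⱼₖ = λⱼ ⊗ λₖ` of two spins `1/2`. -/
def productOp (j k : Fin 4) : Matrix (Fin 2 × Fin 2) (Fin 2 × Fin 2) ℂ :=
  pauli j ⊗ₖ pauli k

/-- The Ising drift `H_f = h⁰³ Λ₀₃ + h³⁰ Λ₃₀ + h³³ Λ₃₃`. -/
def isingHamiltonian (h03 h30 h33 : ℝ) : Matrix (Fin 2 × Fin 2) (Fin 2 × Fin 2) ℂ :=
  (h03 : ℂ) • productOp 0 3 + (h30 : ℂ) • productOp 3 0 + (h33 : ℂ) • productOp 3 3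

/-- The nonselective control Hamiltonian `H_c,ns = Λ₀₁ + Λ₁₀`. -/
def nonselectiveHamiltonian : Matrix (Fin 2 × Fin 2) (Fin 2 × Fin 2) ℂ :=
  productOp 0 1 + productOp 1 0

section Controllability

variable {n : Type*} [Fintype n] [DecidableEq n]

/-- `X` solves the Schrödinger equation `X' = -i (H₀ + u H₁) X` on `[0, T]`
(the derivative of a matrix function is taken entrywise). -/
def IsPropagator (H₀ H₁ : Matrix n n ℂ) (u : ℝ → ℝ) (T : ℝ) (X : ℝ → Matrix n n ℂ) : Prop :=
  ∀ t ∈ Set.Icc (0 : ℝ) T, ∀ i j : n,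
    HasDerivWithinAt (fun s => X s i j)
      ((-Complex.I • ((H₀ + (u t : ℂ) • H₁) * X t)) i j) (Set.Icc (0 : ℝ) T) t

/-- `ρ` solves the forced Liouville-von Neumann equation `ρ' = -i [H₀ + u H₁, ρ]` on `[0, T]`. -/
def IsLiouvilleSolution (H₀ H₁ : Matrix n n ℂ) (u : ℝ → ℝ) (T : ℝ)
    (ρ : ℝ → Matrix n n ℂ) : Prop :=
  ∀ t ∈ Set.Icc (0 : ℝ) T, ∀ i j : n,
    HasDerivWithinAt (fun s => ρ s i j)
      ((-Complex.I • ((H₀ + (u t : ℂ) • H₁) * ρ t - ρ t * (H₀ + (u t : ℂ) • H₁))) i j)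
      (Set.Icc (0 : ℝ) T) t

/-- Density matrices: positive semidefinite matrices of trace one. -/
def IsDensity (ρ : Matrix n n ℂ) : Prop :=
  ρ.PosSemidef ∧ ρ.trace = 1

/-- Controllability of the evolution operator: any element of the special unitary group can be
steered to any other one in finite positive time by a smooth real control. -/
def OperatorControllable (H₀ H₁ : Matrix n n ℂ) : Prop :=
  ∀ U ∈ Matrix.specialUnitaryGroup n ℂ, ∀ V ∈ Matrix.specialUnitaryGroup n ℂ,
    ∃ (T : ℝ) (u : ℝ → ℝ) (X : ℝ → Matrix n n ℂ),
      0 < T ∧ ContDiff ℝ ∞ u ∧ IsPropagator H₀ H₁ u T X ∧ X 0 = U ∧ X T = V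

/-- Controllability of the density operator: any density matrix can be steered to any density
matrix that is unitarily equivalent to it in finite positive time by a smooth real control. -/
def DensityControllable (H₀ H₁ : Matrix n n ℂ) : Prop :=
  ∀ ρ₀ ρ₁ : Matrix n n ℂ, IsDensity ρ₀ → IsDensity ρ₁ →
    (∃ W ∈ Matrix.unitaryGroup n ℂ, ρ₁ = W * ρ₀ * Wᴴ) →
    ∃ (T : ℝ) (u : ℝ → ℝ) (ρ : ℝ → Matrix n n ℂ),
      0 < T ∧ ContDiff ℝ ∞ u ∧ IsLiouvilleSolution H₀ H₁ u T ρ ∧ ρ 0 = ρ₀ ∧ ρ T = ρ₁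

end Controllability

end SpinControl

end

/-! Put `A = -i H_f`, `B = -i H_c,ns`, and let `S` be the set `reachable A B`. The proof shows that
`S` contains all of SU(4); both claims follow by right translation and by conjugation. `S` is a
semigroup of unitaries, and its closure is stable under inverses because inverses in a compact group
are limits of powers. The closure contains `exp (s A)` for every real `s`, and also `exp (s B)`,
approximated by short strong pulses. The real span of the conjugates `g A g*` with `g` in `S` is
invariant under conjugation by the closure; differentiating, it is stable under commutators with `A`
and `B`. It contains `A`, so by the explicit computation `mem_of_stable` it is all of su(4).
Finitely many conjugates `gᵢ A gᵢ*` then span su(4). The product of the `gᵢ exp (tᵢ A) qᵢ`, with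
`qᵢ` in `S` close to `exp (-A) gᵢ*` and `tᵢ` close to 1, covers a neighbourhood of 1 in SU(4) by an
open mapping argument (`eventually_mem_reachable`). Thus exact, not just approximate, reachability
holds near 1. Since each special unitary matrix is `exp K` with `K` in su(4), and so a power of `exp
(K / k)`, it holds everywhere (`specialUnitaryGroup_subset_reachable`). -/

noncomputable section

namespace SpinControl

set_option linter.unusedSectionVars false

section Analysis

open Set Filter Topology
open scoped Matrix.Norms.L2Operator NNReal

/-! ### Linear equations with skew-Hermitian generator. -/

section LinearODE

variable {n : Type*} [Fintype n] [DecidableEq n]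

/-- `X` solves the linear equation `X' = G X` on `[a, b]`. -/
def IsSolution (G : ℝ → Matrix n n ℂ) (a b : ℝ) (X : ℝ → Matrix n n ℂ) : Prop :=
  ∀ t ∈ Icc a b, HasDerivWithinAt X (G t * X t) (Icc a b) t

theorem eq_of_hasDerivWithinAt_zero {E : Type*} [NormedAddCommGroup E] [NormedSpace ℝ E]
    {f : ℝ → E} {a b : ℝ} (h : ∀ t ∈ Icc a b, HasDerivWithinAt f 0 (Icc a b) t) :
    ∀ t ∈ Icc a b, f t = f a :=
  constant_of_derivWithin_zero (fun t ht => (h t ht).differentiableWithinAt) fun t ht =>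
    (h t ⟨ht.1, ht.2.le⟩).derivWithin
      (uniqueDiffOn_Icc (ht.1.trans_lt ht.2) t ⟨ht.1, ht.2.le⟩)

/-- The derivative is `X* (G* + G) Y = 0`. This one conservation law yields both unitarity (`Y = X`)
and uniqueness of solutions. -/
theorem IsSolution.star_mul_eq {G : ℝ → Matrix n n ℂ} {a b : ℝ} {X Y : ℝ → Matrix n n ℂ}
    (hG : ∀ t ∈ Icc a b, star (G t) = -G t) (hX : IsSolution G a b X) (hY : IsSolution G a b Y) :
    ∀ t ∈ Icc a b, star (X t) * Y t = star (X a) * Y a := by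
  refine eq_of_hasDerivWithinAt_zero (f := fun t => star (X t) * Y t) fun t ht => ?_
  refine ((hX t ht).star.mul (hY t ht)).congr_deriv ?_
  rw [star_mul, hG t ht]
  noncomm_ring

theorem IsSolution.mono {G : ℝ → Matrix n n ℂ} {a b c d : ℝ} {X : ℝ → Matrix n n ℂ}
    (hX : IsSolution G a b X) (h : Icc c d ⊆ Icc a b) : IsSolution G c d X :=
  fun t ht => (hX t (h ht)).mono h

theorem IsSolution.mul_const {G : ℝ → Matrix n n ℂ} {a b : ℝ} {X : ℝ → Matrix n n ℂ}
    (hX : IsSolution G a b X) (V : Matrix n n ℂ) : IsSolution G a b (fun t => X t * V) :=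
  fun t ht => ((hX t ht).mul_const V).congr_deriv (mul_assoc _ _ _)

theorem IsSolution.mem_unitary {G : ℝ → Matrix n n ℂ} {a b : ℝ} {X : ℝ → Matrix n n ℂ}
    (hG : ∀ t ∈ Icc a b, star (G t) = -G t) (hX : IsSolution G a b X)
    (h1 : X a ∈ Matrix.unitaryGroup n ℂ) : ∀ t ∈ Icc a b, X t ∈ Matrix.unitaryGroup n ℂ := by
  intro t ht
  rw [Matrix.mem_unitaryGroup_iff', hX.star_mul_eq hG hX t ht]
  exact Matrix.mem_unitaryGroup_iff'.1 h1

theorem norm_le_one_of_mem_unitary {U : Matrix n n ℂ} (hU : U ∈ Matrix.unitaryGroup n ℂ) :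
    ‖U‖ ≤ 1 := by
  cases isEmpty_or_nonempty n
  · rw [Subsingleton.elim U 0, norm_zero]; exact zero_le_one
  · exact (CStarRing.norm_of_mem_unitary hU).le

/-- The right-hand side is cut off outside the ball of radius 2, which makes it bounded and globally
Lipschitz, so Picard–Lindelöf applies on the whole interval at once. The truncated generator is a
real multiple of `G`, hence still skew; its solution is unitary, has norm at most 1, and never meets
the cutoff. -/
theorem exists_isSolution {G : ℝ → Matrix n n ℂ} (hc : Continuous G)
    (hG : ∀ t, star (G t) = -G t) {T : ℝ} (hT : 0 ≤ T) :
    ∃ X, IsSolution G 0 T X ∧ X 0 = 1 := by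
  let h : ContDiffBump (0 : Matrix n n ℂ) := ⟨2, 3, by norm_num, by norm_num⟩
  let φ : Matrix n n ℂ → Matrix n n ℂ := fun X => h X • X
  have hφ : ContDiff ℝ 1 φ := h.contDiff.smul contDiff_id
  have hφs : HasCompactSupport φ := h.hasCompactSupport.smul_right
  obtain ⟨K, hK⟩ := hφ.lipschitzWith_of_hasCompactSupport hφs one_ne_zero
  obtain ⟨C, hC⟩ := hφs.exists_bound_of_continuous hφ.continuous
  obtain ⟨M, hM⟩ := (isCompact_Icc (a := 0) (b := T)).exists_bound_of_continuousOn hc.continuousOn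
  have hCn : (0 : ℝ) ≤ C := (norm_nonneg _).trans (hC 0)
  have hMn : (0 : ℝ) ≤ M := (norm_nonneg _).trans (hM 0 ⟨le_rfl, hT⟩)
  lift C to ℝ≥0 using hCn
  lift M to ℝ≥0 using hMn
  have hP : IsPicardLindelof (fun t X => G t * φ X) (⟨0, le_rfl, hT⟩ : Icc (0 : ℝ) T) 1
      (M * C * ⟨T, hT⟩) 0 (M * C) (M * K) := by
    refine ⟨fun t ht => ?_, fun x _ => (hc.mul continuous_const).continuousOn, fun t ht x _ => ?_, ?_⟩
    · refine (LipschitzWith.of_dist_le_mul fun x y => ?_).lipschitzOnWith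
      rw [dist_eq_norm, ← mul_sub, NNReal.coe_mul, mul_assoc]
      refine (norm_mul_le _ _).trans (mul_le_mul (hM t ht) ?_ (norm_nonneg _) M.2)
      rw [← dist_eq_norm]
      exact hK.dist_le_mul x y
    · exact (norm_mul_le _ _).trans (mul_le_mul (hM t ht) (hC x) (norm_nonneg _) M.2)
    · simp [hT]
      rfl
  obtain ⟨X, hX0, hX⟩ := hP.exists_eq_forall_mem_Icc_hasDerivWithinAt₀
  have hX' : IsSolution (fun t => h (X t) • G t) 0 T X := by
    intro t ht
    refine (hX t ht).congr_deriv ?_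
    simp only [φ, mul_smul_comm, smul_mul_assoc]
  have hu := hX'.mem_unitary (fun t _ => by rw [star_smul, hG, star_trivial, smul_neg])
    (hX0 ▸ one_mem (Matrix.unitaryGroup n ℂ))
  refine ⟨X, fun t ht => ?_, hX0⟩
  refine (hX' t ht).congr_deriv ?_
  change (h (X t) • G t) * X t = _
  rw [h.one_of_mem_closedBall, one_smul]
  rw [mem_closedBall_zero_iff]
  exact (norm_le_one_of_mem_unitary (hu t ht)).trans (by norm_num [h])

end LinearODE

/-! ### The reachable semigroup and its impulsive limits. -/

section Reachable

variable {n : Type*} [Fintype n] [DecidableEq n]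

theorem contDiff_det : ContDiff ℝ ∞ (fun M : Matrix n n ℂ => M.det) := by
  simp only [Matrix.det_apply]
  refine ContDiff.sum fun σ _ => ContDiff.const_smul _ (contDiff_prod fun i _ => ?_)
  exact (Matrix.entryLinearMap ℝ ℂ (σ i) i).toContinuousLinearMap.contDiff

theorem hasFDerivAt_det_one :
    ∃ L : Matrix n n ℂ →L[ℝ] ℂ, HasFDerivAt (fun M : Matrix n n ℂ => M.det) L 1 ∧
      ∀ M, L M = M.trace := by
  have hd := (contDiff_det (n := n)).differentiable (by simp) |>.differentiableAt (x := 1)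
  refine ⟨_, hd.hasFDerivAt, fun M => ?_⟩
  have h1 : HasDerivAt (fun s : ℝ => (1 + s • M).det) (fderiv ℝ (fun M : Matrix n n ℂ => M.det) 1 M) 0 := by
    have h2 : HasDerivAt (fun s : ℝ => 1 + s • M) M 0 := by
      simpa using ((hasDerivAt_id (0 : ℝ)).smul_const M).const_add 1
    exact HasFDerivAt.comp_hasDerivAt_of_eq (0 : ℝ) hd.hasFDerivAt h2 (by simp)
  have h2 : HasDerivAt (fun s : ℝ => (1 + s • M).det) M.trace 0 := by
    have h3 : (fun s : ℝ => (1 + s • M).det) = fun s : ℝ => 1 + M.trace * (s : ℂ) +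
        (Matrix.det (1 + (Polynomial.X : Polynomial ℂ) • M.map Polynomial.C)).divX.divX.eval (s : ℂ)
          * (s : ℂ) ^ 2 := by
      funext s
      rw [← Matrix.det_one_add_smul, Complex.coe_smul]
    rw [h3]
    set p := (Matrix.det (1 + (Polynomial.X : Polynomial ℂ) • M.map Polynomial.C)).divX.divX
    have h4 : HasDerivAt (fun z : ℂ => 1 + M.trace * z + p.eval z * z ^ 2) M.trace ((0 : ℝ) : ℂ) := by
      have h5 := (((hasDerivAt_id (0 : ℂ)).const_mul M.trace).const_add 1).add
        ((p.hasDerivAt 0).mul ((hasDerivAt_id (0 : ℂ)).pow 2))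
      exact h5.congr_deriv (by simp)
    exact h4.comp_ofReal
  exact h1.unique h2

/-- Near time `t`, `det (X s) = det (X s * star (X t)) * det (X t)`. The first factor has derivative
`tr (G t) = 0` at `s = t`, so only the derivative of `det` at 1 is needed. -/
theorem IsSolution.det_eq {G : ℝ → Matrix n n ℂ} {a b : ℝ} {X : ℝ → Matrix n n ℂ}
    (hG : ∀ t ∈ Icc a b, (G t).trace = 0) (hX : IsSolution G a b X)
    (hU : ∀ t ∈ Icc a b, X t ∈ Matrix.unitaryGroup n ℂ) :
    ∀ t ∈ Icc a b, (X t).det = (X a).det := by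
  obtain ⟨L, hL, hLt⟩ := hasFDerivAt_det_one (n := n)
  refine eq_of_hasDerivWithinAt_zero fun t ht => ?_
  have h1 : X t * star (X t) = 1 := Matrix.mem_unitaryGroup_iff.1 (hU t ht)
  have h2 : star (X t) * X t = 1 := Matrix.mem_unitaryGroup_iff'.1 (hU t ht)
  have h3 : HasDerivWithinAt (fun s => X s * star (X t)) (G t) (Icc a b) t :=
    ((hX t ht).mul_const _).congr_deriv (by rw [mul_assoc, h1, mul_one])
  have h4 := (hL.comp_hasDerivWithinAt_of_eq t h3 h1.symm).mul_const (X t).det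
  rw [hLt, hG t ht, zero_mul] at h4
  refine h4.congr_of_mem (fun s _ => ?_) ht
  simp only [Function.comp_apply]
  rw [← Matrix.det_mul, mul_assoc, h2, mul_one]

/-- The matrices reached from the identity in positive time along `X' = (A + u B) X` by smooth
controls that vanish outside of the time interval. -/
def reachable (A B : Matrix n n ℂ) : Set (Matrix n n ℂ) :=
  {V | ∃ (T : ℝ) (u : ℝ → ℝ) (X : ℝ → Matrix n n ℂ), 0 < T ∧ ContDiff ℝ ∞ u ∧
    (∀ t ≤ 0, u t = 0) ∧ (∀ t, T ≤ t → u t = 0) ∧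
    IsSolution (fun t => A + u t • B) 0 T X ∧ X 0 = 1 ∧ X T = V}

variable {A B : Matrix n n ℂ}

theorem star_control (hA : star A = -A) (hB : star B = -B) (r : ℝ) :
    star (A + r • B) = -(A + r • B) := by
  rw [star_add, star_smul, hA, hB, star_trivial, smul_neg, neg_add]

theorem continuous_control {u : ℝ → ℝ} (hu : ContDiff ℝ ∞ u) (A B : Matrix n n ℂ) :
    Continuous fun t => A + u t • B :=
  continuous_const.add (hu.continuous.smul continuous_const)

theorem reachable_subset (hA : star A = -A) (hB : star B = -B) (hA0 : A.trace = 0)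
    (hB0 : B.trace = 0) : reachable A B ⊆ Matrix.specialUnitaryGroup n ℂ := by
  rintro V ⟨T, u, X, hT, -, -, -, hX, hX0, rfl⟩
  have hU := hX.mem_unitary (fun t _ => star_control hA hB _) (hX0 ▸ one_mem _)
  refine Matrix.mem_specialUnitaryGroup_iff.2 ⟨hU T ⟨hT.le, le_rfl⟩, ?_⟩
  rw [hX.det_eq (fun t _ => by simp [hA0, hB0]) hU T ⟨hT.le, le_rfl⟩, hX0, Matrix.det_one]

theorem IsSolution.congr {G G' : ℝ → Matrix n n ℂ} {a b : ℝ} {X : ℝ → Matrix n n ℂ}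
    (hX : IsSolution G a b X) (h : ∀ t ∈ Icc a b, G t = G' t) : IsSolution G' a b X :=
  fun t ht => h t ht ▸ hX t ht

theorem IsSolution.shift {G : ℝ → Matrix n n ℂ} {b : ℝ} {X : ℝ → Matrix n n ℂ}
    (hX : IsSolution G 0 b X) (a : ℝ) :
    IsSolution (fun t => G (t - a)) a (a + b) (fun t => X (t - a)) := by
  intro t ht
  have h1 : HasDerivWithinAt (fun s : ℝ => s - a) 1 (Icc a (a + b)) t :=
    ((hasDerivAt_id t).sub_const a).hasDerivWithinAt
  have h2 : MapsTo (fun s : ℝ => s - a) (Icc a (a + b)) (Icc 0 b) := fun s hs =>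
    ⟨by linarith [hs.1], by linarith [hs.2]⟩
  exact ((hX (t - a) (h2 ht)).scomp t h1 h2).congr_deriv (one_smul _ _)

theorem IsSolution.eq_mul {G : ℝ → Matrix n n ℂ} {a b : ℝ} {X Y : ℝ → Matrix n n ℂ}
    (hab : a ≤ b) (hG : ∀ t ∈ Icc a b, star (G t) = -G t) (hX : IsSolution G a b X)
    (hY : IsSolution G a b Y) (hX1 : X a = 1) : Y b = X b * Y a := by
  have h1 := hX.star_mul_eq hG hY b ⟨hab, le_rfl⟩
  have h2 := hX.mem_unitary hG (hX1 ▸ one_mem _) b ⟨hab, le_rfl⟩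
  rw [hX1, star_one, one_mul] at h1
  rw [← h1, ← mul_assoc, Matrix.mem_unitaryGroup_iff.1 h2, one_mul]

/-- Controls vanish outside their time intervals, so the sum of `u₁` and the delayed `u₂` is smooth
and realizes the concatenation: `V` first, then `W`. -/
theorem mul_mem_reachable (hA : star A = -A) (hB : star B = -B) {V W : Matrix n n ℂ}
    (hV : V ∈ reachable A B) (hW : W ∈ reachable A B) : W * V ∈ reachable A B := by
  obtain ⟨T₁, u₁, X₁, hT₁, hu₁, h0₁, h1₁, hX₁, hX0₁, rfl⟩ := hV
  obtain ⟨T₂, u₂, X₂, hT₂, hu₂, h0₂, h1₂, hX₂, hX0₂, rfl⟩ := hW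
  have hu : ContDiff ℝ ∞ fun t => u₁ t + u₂ (t - T₁) :=
    hu₁.add (hu₂.comp (contDiff_id.sub contDiff_const))
  have hs := fun t => star_control hA hB (u₁ t + u₂ (t - T₁))
  obtain ⟨X, hX, hX0⟩ := exists_isSolution (continuous_control hu A B) hs (add_pos hT₁ hT₂).le
  refine ⟨T₁ + T₂, _, X, add_pos hT₁ hT₂, hu, fun t ht => ?_, fun t ht => ?_, hX, hX0, ?_⟩
  · simp [h0₁ t ht, h0₂ (t - T₁) (by linarith)]
  · simp [h1₁ t (by linarith), h1₂ (t - T₁) (by linarith)]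
  · have hY₁ : IsSolution (fun t => A + (u₁ t + u₂ (t - T₁)) • B) 0 T₁ X₁ :=
      hX₁.congr fun t ht => by rw [h0₂ (t - T₁) (by linarith [ht.2]), add_zero]
    have hY₂ : IsSolution (fun t => A + (u₁ t + u₂ (t - T₁)) • B) T₁ (T₁ + T₂)
        (fun t => X₂ (t - T₁)) :=
      (hX₂.shift T₁).congr fun t ht => by rw [h1₁ t ht.1, zero_add]
    have e₁ := hY₁.eq_mul hT₁.le (fun t _ => hs t)
      (hX.mono (Icc_subset_Icc le_rfl (by linarith))) hX0₁
    have e₂ := hY₂.eq_mul (by linarith) (fun t _ => hs t)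
      (hX.mono (Icc_subset_Icc hT₁.le le_rfl)) (by simp [hX0₂])
    rw [e₂, e₁, hX0, mul_one, add_sub_cancel_left]

theorem exp_smul_drift_mem_reachable (A B : Matrix n n ℂ) {t : ℝ} (ht : 0 < t) :
    NormedSpace.exp (t • A) ∈ reachable A B := by
  refine ⟨t, 0, fun s => NormedSpace.exp (s • A), ht, contDiff_const, fun _ _ => rfl,
    fun _ _ => rfl, fun s _ => ?_, by simp, rfl⟩
  simpa using (hasDerivAt_exp_smul_const' (𝕂 := ℝ) A s).hasDerivWithinAt

theorem exp_mem_unitary {K : Matrix n n ℂ} (hK : star K = -K) :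
    NormedSpace.exp K ∈ Matrix.unitaryGroup n ℂ :=
  letI : NormedAlgebra ℚ (Matrix n n ℂ) := NormedAlgebra.restrictScalars ℚ ℂ _
  NormedSpace.exp_mem_unitary_of_mem_skewAdjoint (skewAdjoint.mem_iff.2 hK)

theorem norm_unitary_mul_mul_le {U V M : Matrix n n ℂ} (hU : U ∈ Matrix.unitaryGroup n ℂ)
    (hV : V ∈ Matrix.unitaryGroup n ℂ) : ‖U * M * V‖ ≤ ‖M‖ := by
  have h1 := norm_le_one_of_mem_unitary hU
  have h2 := norm_le_one_of_mem_unitary hV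
  calc ‖U * M * V‖ ≤ ‖U‖ * ‖M‖ * ‖V‖ := norm_mul₃_le
    _ ≤ 1 * ‖M‖ * 1 := by gcongr
    _ = ‖M‖ := by ring

theorem star_smul_skew {K : Matrix n n ℂ} (hK : star K = -K) (r : ℝ) :
    star (r • K) = -(r • K) := by
  rw [star_smul, star_trivial, hK, smul_neg]

theorem exists_control_of_impulse (s : ℝ) {T : ℝ} (hT : 0 < T) :
    ∃ θ u : ℝ → ℝ, ContDiff ℝ ∞ u ∧ (∀ t ≤ 0, u t = 0) ∧ (∀ t, T ≤ t → u t = 0) ∧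
      (∀ t, HasDerivAt θ (u t) t) ∧ θ 0 = 0 ∧ θ T = s := by
  let θ : ℝ → ℝ := fun t => s * Real.smoothTransition (t / T)
  have hθ : ContDiff ℝ ∞ θ :=
    contDiff_const.mul (Real.smoothTransition.contDiff.comp (contDiff_id.div_const T))
  have hd : ∀ t, HasDerivAt θ (deriv θ t) t := fun t =>
    (hθ.differentiable (by simp) t).hasDerivAt
  have hz : ∀ (S : Set ℝ) (c t : ℝ), t ∈ S → UniqueDiffOn ℝ S → (∀ x ∈ S, θ x = c) →
      deriv θ t = 0 := fun S c t ht hS hc =>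
    (hS t ht).eq_deriv _ (hd t).hasDerivWithinAt
      ((hasDerivWithinAt_const t S c).congr_of_mem hc ht)
  refine ⟨θ, deriv θ, ?_, fun t ht => ?_, fun t ht => ?_, hd, ?_, ?_⟩
  · exact ((contDiff_infty_iff_deriv (𝕜 := ℝ)).1 hθ).2
  · refine hz (Iic 0) 0 t ht (uniqueDiffOn_Iic 0) fun x hx => ?_
    simp only [θ, Real.smoothTransition.zero_of_nonpos (div_nonpos_of_nonpos_of_nonneg hx hT.le),
      mul_zero]
  · refine hz (Ici T) s t ht (uniqueDiffOn_Ici T) fun x hx => ?_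
    simp only [θ, Real.smoothTransition.one_of_one_le ((one_le_div hT).2 hx), mul_one]
  · simp [θ]
  · simp [θ, hT.ne']

/-- A pulse of total area `s` and duration `T` acts like `exp (s B)` as `T` tends to 0. In the
moving frame `E = exp (-θ B)` the control disappears: `E X` has derivative `E A X`, of norm at most
`‖A‖`, and so moves by at most `‖A‖ T`. -/
theorem exp_smul_control_mem_closure (hA : star A = -A) (hB : star B = -B) (s : ℝ) :
    NormedSpace.exp (s • B) ∈ closure (reachable A B) := by
  refine Metric.mem_closure_iff.2 fun ε hε => ?_
  have hA1 : 0 < ‖A‖ + 1 := by positivity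
  set T := ε / (2 * (‖A‖ + 1))
  have hT : 0 < T := by positivity
  obtain ⟨θ, u, hu, h0, h1, hθ, hθ0, hθT⟩ := exists_control_of_impulse s hT
  obtain ⟨X, hX, hX0⟩ := exists_isSolution (continuous_control hu A B)
    (fun t => star_control hA hB _) hT.le
  refine ⟨X T, ⟨T, u, X, hT, hu, h0, h1, hX, hX0, rfl⟩, ?_⟩
  have hXu := hX.mem_unitary (fun t _ => star_control hA hB _) (hX0 ▸ one_mem _)
  let E : ℝ → Matrix n n ℂ := fun t => NormedSpace.exp (-θ t • B)
  have hEu : ∀ t, E t ∈ Matrix.unitaryGroup n ℂ := fun t => exp_mem_unitary (star_smul_skew hB _)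
  have hE : ∀ t, HasDerivAt E (-u t • (E t * B)) t := fun t => by
    have := HasDerivAt.scomp t (hasDerivAt_exp_smul_const (𝕂 := ℝ) B (-θ t)) (hθ t).neg
    exact this
  have hY : ∀ t ∈ Icc 0 T, HasDerivWithinAt (fun t => E t * X t) (E t * A * X t) (Icc 0 T) t := by
    intro t ht
    refine ((hE t).hasDerivWithinAt.mul (hX t ht)).congr_deriv ?_
    change (-u t • (E t * B)) * X t + E t * ((A + u t • B) * X t) = _
    rw [neg_smul, neg_mul, smul_mul_assoc, add_mul, mul_add, smul_mul_assoc, mul_smul_comm,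
      mul_assoc (E t) B, mul_assoc (E t) A]
    abel
  have h2 := norm_image_sub_le_of_norm_deriv_le_segment' hY
    (fun t ht => norm_unitary_mul_mul_le (hEu t) (hXu t ⟨ht.1, ht.2.le⟩)) T ⟨hT.le, le_rfl⟩
  have hEinv : NormedSpace.exp (s • B) * E T = 1 := by
    simp only [E, hθT, neg_smul]
    rw [← Matrix.exp_add_of_commute _ _ (Commute.neg_right (Commute.refl (s • B))), add_neg_cancel,
      NormedSpace.exp_zero]
  have h3 : X T - NormedSpace.exp (s • B) =
      NormedSpace.exp (s • B) * (E T * X T - E 0 * X 0) * 1 := by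
    have : E 0 = 1 := by simp [E, hθ0]
    rw [this, hX0, mul_one, mul_one, mul_sub, ← mul_assoc, hEinv, one_mul, mul_one]
  rw [dist_comm, dist_eq_norm, h3]
  refine (norm_unitary_mul_mul_le (exp_mem_unitary (star_smul_skew hB _)) (one_mem _)).trans_lt
    (h2.trans_lt ?_)
  have : (‖A‖ + 1) * T = ε / 2 := by simp only [T]; field_simp
  nlinarith [norm_nonneg A]

end Reachable

/-! ### The closure of the semigroup and the invariant span of conjugates of the drift. -/

section Closure

variable {n : Type*} [Fintype n] [DecidableEq n]

instance compactSpace_unitaryGroup : CompactSpace (Matrix.unitaryGroup n ℂ) := by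
  have : ProperSpace (Matrix n n ℂ) := FiniteDimensional.proper ℝ _
  exact isCompact_iff_compactSpace.1 <| Metric.isCompact_of_isClosed_isBounded
    (isClosed_unitary (R := Matrix n n ℂ)) <|
    isBounded_iff_forall_norm_le.2 ⟨1, fun _ hU => norm_le_one_of_mem_unitary hU⟩

theorem mul_mem_closure {S : Set (Matrix n n ℂ)} (hm : ∀ g ∈ S, ∀ h ∈ S, g * h ∈ S)
    {g h : Matrix n n ℂ} (hg : g ∈ closure S) (hh : h ∈ closure S) : g * h ∈ closure S :=
  map_mem_closure₂ continuous_mul hg hh hm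

theorem star_mem_closure {S : Set (Matrix n n ℂ)} (hm : ∀ g ∈ S, ∀ h ∈ S, g * h ∈ S)
    (hS : S ⊆ Matrix.unitaryGroup n ℂ) {g : Matrix n n ℂ} (hg : g ∈ closure S) :
    star g ∈ closure S := by
  have hgU : g ∈ Matrix.unitaryGroup n ℂ :=
    closure_minimal hS (isClosed_unitary (R := Matrix n n ℂ)) hg
  let γ : Matrix.unitaryGroup n ℂ := ⟨g, hgU⟩
  have h1 : MapClusterPt γ⁻¹ atTop (γ ^ · : ℕ → Matrix.unitaryGroup n ℂ) :=
    mapClusterPt_inv_atTop_pow.2 (mapClusterPt_self_atTop_pow γ)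
  have h2 := h1.continuousAt_comp (f := fun U : Matrix.unitaryGroup n ℂ => (U : Matrix n n ℂ))
    continuous_subtype_val.continuousAt
  have h3 : ∀ k : ℕ, g ^ (k + 1) ∈ closure S := by
    intro k
    induction k with
    | zero => simpa using hg
    | succ k ih => rw [pow_succ]; exact mul_mem_closure hm ih hg
  -- Only positive powers are used, since 1 is not assumed to lie in `S`.
  refine isClosed_closure.mem_of_mapClusterPt h2 ((eventually_ge_atTop 1).mono fun k hk => ?_)
  obtain ⟨k, rfl⟩ := Nat.exists_eq_add_of_le' hk
  exact h3 k

/-- The real span of the conjugates of `A` by elements of `S`. -/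
def conjSpan (S : Set (Matrix n n ℂ)) (A : Matrix n n ℂ) : Submodule ℝ (Matrix n n ℂ) :=
  Submodule.span ℝ ((fun g => g * A * star g) '' S)

/-- Invariance under `S` itself holds on generators; a finite-dimensional subspace is closed, so it
passes to the closure. -/
theorem conj_mem_conjSpan {S : Set (Matrix n n ℂ)} (hm : ∀ g ∈ S, ∀ h ∈ S, g * h ∈ S)
    {A g M : Matrix n n ℂ} (hg : g ∈ closure S) (hM : M ∈ conjSpan S A) :
    g * M * star g ∈ conjSpan S A := by
  have hc : IsClosed (conjSpan S A : Set (Matrix n n ℂ)) := Submodule.closed_of_finiteDimensional _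
  refine closure_minimal (fun g hg => ?_)
    (hc.preimage (by fun_prop : Continuous fun g : Matrix n n ℂ => g * M * star g)) hg
  change g * M * star g ∈ conjSpan S A
  induction hM using Submodule.span_induction with
  | mem x hx =>
    obtain ⟨h, hh, rfl⟩ := hx
    refine Submodule.subset_span ⟨g * h, hm g hg h hh, ?_⟩
    simp only [star_mul, mul_assoc]
  | zero => simp
  | add x y _ _ hx hy => rw [mul_add, add_mul]; exact add_mem hx hy
  | smul r x _ hx =>
    rw [mul_smul_comm, smul_mul_assoc]
    exact Submodule.smul_mem _ r hx

theorem hasDerivAt_exp_conj {K : Matrix n n ℂ} (hK : star K = -K) (M : Matrix n n ℂ) :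
    HasDerivAt (fun s : ℝ => NormedSpace.exp (s • K) * M * star (NormedSpace.exp (s • K)))
      (K * M - M * K) 0 := by
  have h1 := hasDerivAt_exp_smul_const (𝕂 := ℝ) K (0 : ℝ)
  refine ((h1.mul_const M).mul h1.star).congr_deriv ?_
  simp [hK, sub_eq_add_neg]

/-- The commutator is the velocity at `s = 0` of a curve that stays in a closed subspace. -/
theorem commutator_mem_of_exp_conj_mem {W : Submodule ℝ (Matrix n n ℂ)} {K M : Matrix n n ℂ}
    (hK : star K = -K)
    (h : ∀ s : ℝ, NormedSpace.exp (s • K) * M * star (NormedSpace.exp (s • K)) ∈ W) :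
    K * M - M * K ∈ W := by
  have hc : IsClosed (W : Set (Matrix n n ℂ)) := Submodule.closed_of_finiteDimensional _
  refine hc.mem_of_tendsto (hasDerivAt_iff_tendsto_slope.1 (hasDerivAt_exp_conj hK M))
    (Eventually.of_forall fun s => ?_)
  rw [slope_def_module]
  exact W.smul_mem _ (W.sub_mem (h s) (h 0))

variable {A B : Matrix n n ℂ}

theorem reachable_subset_unitary (hA : star A = -A) (hB : star B = -B) :
    reachable A B ⊆ Matrix.unitaryGroup n ℂ := by
  rintro V ⟨T, u, X, hT, -, -, -, hX, hX0, rfl⟩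
  exact hX.mem_unitary (fun t _ => star_control hA hB _) (hX0 ▸ one_mem _) T ⟨hT.le, le_rfl⟩

theorem one_mem_closure_reachable (hA : star A = -A) (hB : star B = -B) :
    (1 : Matrix n n ℂ) ∈ closure (reachable A B) := by
  simpa using exp_smul_control_mem_closure hA hB 0

theorem exp_smul_drift_mem_closure (hA : star A = -A) (hB : star B = -B) (s : ℝ) :
    NormedSpace.exp (s • A) ∈ closure (reachable A B) := by
  rcases lt_trichotomy s 0 with hs | rfl | hs
  · have h1 : star (NormedSpace.exp ((-s) • A)) = NormedSpace.exp (s • A) := by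
      rw [Matrix.star_eq_conjTranspose, ← Matrix.exp_conjTranspose, ← Matrix.star_eq_conjTranspose,
        star_smul_skew hA, neg_smul, neg_neg]
    rw [← h1]
    exact star_mem_closure (fun g hg h hh => mul_mem_reachable hA hB hh hg)
      (reachable_subset_unitary hA hB)
      (subset_closure (exp_smul_drift_mem_reachable A B (neg_pos.2 hs)))
  · simpa using one_mem_closure_reachable hA hB
  · exact subset_closure (exp_smul_drift_mem_reachable A B hs)

theorem drift_mem_conjSpan (hA : star A = -A) : A ∈ conjSpan (reachable A B) A := by
  refine Submodule.subset_span ⟨_, exp_smul_drift_mem_reachable A B one_pos, ?_⟩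
  have h1 : Commute A (NormedSpace.exp ((1 : ℝ) • A)) := by
    simpa using (Commute.refl A).exp_right
  change NormedSpace.exp ((1 : ℝ) • A) * A * _ = A
  rw [← h1.eq, mul_assoc,
    Matrix.mem_unitaryGroup_iff.1 (exp_mem_unitary (star_smul_skew hA _)), mul_one]

theorem commutator_drift_mem_conjSpan (hA : star A = -A) (hB : star B = -B) {M : Matrix n n ℂ}
    (hM : M ∈ conjSpan (reachable A B) A) : A * M - M * A ∈ conjSpan (reachable A B) A :=
  commutator_mem_of_exp_conj_mem hA fun s =>
    conj_mem_conjSpan (fun _ hg _ hh => mul_mem_reachable hA hB hh hg)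
      (exp_smul_drift_mem_closure hA hB s) hM

theorem commutator_control_mem_conjSpan (hA : star A = -A) (hB : star B = -B) {M : Matrix n n ℂ}
    (hM : M ∈ conjSpan (reachable A B) A) : B * M - M * B ∈ conjSpan (reachable A B) A :=
  commutator_mem_of_exp_conj_mem hB fun s =>
    conj_mem_conjSpan (fun _ hg _ hh => mul_mem_reachable hA hB hh hg)
      (exp_smul_control_mem_closure hA hB s) hM

end Closure

/-! ### Exact reachability near the identity. -/

section LocalSurjectivity

variable {n : Type*} [Fintype n] [DecidableEq n]

theorem contDiff_list_prod {E ι : Type*} [NormedAddCommGroup E] [NormedSpace ℝ E]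
    (l : List ι) {f : ι → E → Matrix n n ℂ} (hf : ∀ i, ContDiff ℝ 1 (f i)) :
    ContDiff ℝ 1 fun x => (l.map fun i => f i x).prod := by
  induction l with
  | nil => simpa using contDiff_const
  | cons i l ih => simpa using (hf i).mul ih

theorem list_prod_eq_of_eq_one {ι M : Type*} [Monoid M] {l : List ι} {f : ι → M} {i : ι}
    (hl : l.Nodup) (hi : i ∈ l) (h : ∀ j, j ≠ i → f j = 1) : (l.map f).prod = f i := by
  induction l with
  | nil => simp at hi
  | cons j l ih =>
    rw [List.map_cons, List.prod_cons]
    rcases List.mem_cons.1 hi with rfl | hi'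
    · have : (l.map f).prod = 1 := List.prod_eq_one fun x hx => by
        obtain ⟨k, hk, rfl⟩ := List.mem_map.1 hx
        exact h k fun hki => (List.nodup_cons.1 hl).1 (hki ▸ hk)
      rw [this, mul_one]
    · rw [ih (List.nodup_cons.1 hl).2 hi', h j fun hji => (List.nodup_cons.1 hl).1 (hji ▸ hi'),
        one_mul]

theorem contDiff_exp_matrix : ContDiff ℝ 1 (NormedSpace.exp : Matrix n n ℂ → Matrix n n ℂ) :=
  contDiff_iff_contDiffAt.2 fun x => (NormedSpace.exp_analytic (𝕂 := ℝ) x).contDiffAt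

/-- A special unitary matrix close to `1` that is the sum of a Hermitian matrix and an imaginary
scalar is `1`. -/
theorem eventually_eq_one [Nonempty n] : ∀ᶠ Z in 𝓝 (1 : Matrix n n ℂ),
    Z ∈ Matrix.specialUnitaryGroup n ℂ → (∃ θ : ℝ, Z - star Z = (2 * θ * Complex.I) • 1) → Z = 1 := by
  set N := Fintype.card n
  have hN : (N : ℝ) ≠ 0 := Nat.cast_ne_zero.2 Fintype.card_ne_zero
  have hNc : (N : ℂ) ≠ 0 := Nat.cast_ne_zero.2 Fintype.card_ne_zero
  -- Substituting `Z* = Z - 2iθ` into `Z Z* = 1` gives `Z² - 2iθ Z = 1`, with roots `iθ ± √(1 -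
  -- θ²)`. The functions `c` and `r` recover `θ` and the square root continuously from `Z`; near 1
  -- the factor of the root with the minus sign is invertible, so `Z` is scalar.
  let c : Matrix n n ℂ → ℝ := fun Z => Z.trace.im / N
  let r : Matrix n n ℂ → ℝ := fun Z => √(1 - c Z ^ 2)
  have htr : Continuous fun Z : Matrix n n ℂ => Z.trace := continuous_id.matrix_trace
  have hc : Continuous c := (Complex.continuous_im.comp htr).div_const _
  have hr : Continuous r := (continuous_const.sub (hc.pow 2)).sqrt
  have hc1 : c 1 = 0 := by simp [c, Matrix.trace_one]
  have hr1 : r 1 = 1 := by simp [r, hc1]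
  have e1 : ∀ᶠ Z in 𝓝 (1 : Matrix n n ℂ), c Z ^ 2 < 1 :=
    ((hc.pow 2).tendsto 1).eventually_lt_const (by simp [hc1])
  have e2 : ∀ᶠ Z in 𝓝 (1 : Matrix n n ℂ),
      IsUnit (Z + ((r Z : ℂ) - c Z * Complex.I) • (1 : Matrix n n ℂ)) := by
    have h1 : Continuous fun Z : Matrix n n ℂ =>
        Z + ((r Z : ℂ) - c Z * Complex.I) • (1 : Matrix n n ℂ) :=
      continuous_id.add (((Complex.continuous_ofReal.comp hr).sub
        ((Complex.continuous_ofReal.comp hc).mul continuous_const)).smul continuous_const)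
    refine h1.tendsto 1 (Units.isOpen.mem_nhds ?_)
    have h2 : (1 : Matrix n n ℂ) + ((r 1 : ℂ) - c 1 * Complex.I) • (1 : Matrix n n ℂ)
        = algebraMap ℂ (Matrix n n ℂ) 2 := by
      rw [hr1, hc1, Algebra.algebraMap_eq_smul_one]
      simp [two_smul]
    change IsUnit ((1 : Matrix n n ℂ) + ((r 1 : ℂ) - c 1 * Complex.I) • (1 : Matrix n n ℂ))
    rw [h2]
    exact (IsUnit.mk0 (2 : ℂ) two_ne_zero).map _
  -- At `Z = 1` this sum equals `N`. Its nonvanishing nearby excludes the `N`-th roots of unity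
  -- other than 1.
  have e3 : ∀ᶠ Z in 𝓝 (1 : Matrix n n ℂ), (∑ k ∈ Finset.range N, (Z.trace / N) ^ k : ℂ) ≠ 0 := by
    have h1 : Continuous fun Z : Matrix n n ℂ => (∑ k ∈ Finset.range N, (Z.trace / N) ^ k : ℂ) :=
      continuous_finsetSum _ fun k _ => (htr.div_const _).pow k
    refine (h1.tendsto 1).eventually_ne ?_
    simp [Matrix.trace_one, N]
  filter_upwards [e1, e2, e3] with Z h1 h2 h3 hZ ⟨θ, hθ⟩
  obtain ⟨hZU, hdet⟩ := Matrix.mem_specialUnitaryGroup_iff.1 hZ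
  have hθc : c Z = θ := by
    have := congrArg (fun M : Matrix n n ℂ => M.trace.im) hθ
    simp [Matrix.trace_sub, Matrix.star_eq_conjTranspose, Matrix.trace_conjTranspose,
      Matrix.trace_smul, Matrix.trace_one] at this
    simp only [c, N]
    field_simp
    linarith
  have hstar : star Z = Z - (2 * θ * Complex.I) • 1 := by rw [← hθ]; abel
  have hsq : Z * Z - (2 * θ * Complex.I) • Z = 1 := by
    have := Matrix.mem_unitaryGroup_iff.1 hZU
    rwa [hstar, mul_sub, mul_smul_comm, mul_one] at this
  have hr2 : (r Z : ℂ) ^ 2 = 1 - (θ : ℂ) ^ 2 := by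
    rw [← Complex.ofReal_pow, Real.sq_sqrt (by linarith), hθc]
    push_cast; rfl
  rw [hθc] at h2
  have hfac : (Z + ((r Z : ℂ) - θ * Complex.I) • (1 : Matrix n n ℂ)) *
      (Z - ((r Z : ℂ) + θ * Complex.I) • (1 : Matrix n n ℂ)) = 0 := by
    have : ((r Z : ℂ) - θ * Complex.I) * ((r Z : ℂ) + θ * Complex.I) = 1 := by
      linear_combination hr2 - (θ : ℂ) ^ 2 * Complex.I_sq
    rw [add_mul, mul_sub, mul_sub, mul_smul_comm, mul_one, smul_mul_assoc, one_mul,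
      smul_mul_smul_comm, this, one_mul, one_smul, ← hsq]
    module
  have hZz : Z = ((r Z : ℂ) + θ * Complex.I) • (1 : Matrix n n ℂ) :=
    sub_eq_zero.1 ((h2.mul_right_eq_zero).1 hfac)
  set z : ℂ := (r Z : ℂ) + θ * Complex.I
  have hz : Z.trace / N = z := by
    rw [hZz, Matrix.trace_smul, Matrix.trace_one, smul_eq_mul]
    field_simp
    simp [N, mul_comm]
  have hzN : z ^ N = 1 := by
    rw [hZz, Matrix.det_smul, Matrix.det_one, mul_one] at hdet
    exact hdet
  rw [hz] at h3
  have hz1 : z = 1 := by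
    have := geom_sum_mul z N
    rw [hzN, sub_self] at this
    exact sub_eq_zero.1 ((mul_eq_zero.1 this).resolve_left h3)
  rw [hZz, hz1, one_smul]

/-- The product `∏ᵢ gᵢ exp (tᵢ A) qᵢ` times `1` plus a Hermitian and an imaginary scalar matrix. -/
def switchingMap {ι : Type} [Fintype ι] (A : Matrix n n ℂ) (g : ι → Matrix n n ℂ) :
    ((ι → ℝ) × Matrix n n ℂ × ℝ) × (ι → Matrix n n ℂ) → Matrix n n ℂ := fun x =>
  ((Finset.univ.toList : List ι).map fun i =>
      g i * NormedSpace.exp (x.1.1 i • A) * x.2 i).prod *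
    (1 + (x.1.2.1 + star x.1.2.1) + x.1.2.2 • Complex.I • (1 : Matrix n n ℂ))

theorem contDiff_switchingMap {ι : Type} [Fintype ι] (A : Matrix n n ℂ) (g : ι → Matrix n n ℂ) :
    ContDiff ℝ 1 (switchingMap A g) := by
  refine (contDiff_list_prod _ fun i => ?_).mul ?_
  · have h1 : ContDiff ℝ 1
        fun x : ((ι → ℝ) × Matrix n n ℂ × ℝ) × (ι → Matrix n n ℂ) => x.1.1 i :=
      (contDiff_apply ℝ ℝ i).comp (contDiff_fst.comp contDiff_fst)
    refine ContDiff.mul (contDiff_const.mul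
      (contDiff_exp_matrix.comp (h1.smul contDiff_const))) ?_
    exact (contDiff_apply ℝ (Matrix n n ℂ) i).comp contDiff_snd
  · have h1 : ContDiff ℝ 1
        fun x : ((ι → ℝ) × Matrix n n ℂ × ℝ) × (ι → Matrix n n ℂ) => x.1.2.1 :=
      contDiff_fst.comp (contDiff_snd.comp contDiff_fst)
    have h2 : ContDiff ℝ 1
        fun x : ((ι → ℝ) × Matrix n n ℂ × ℝ) × (ι → Matrix n n ℂ) => x.1.2.2 :=
      contDiff_snd.comp (contDiff_snd.comp contDiff_fst)
    exact (contDiff_const.add (h1.add ((starL' ℝ (A := Matrix n n ℂ)).contDiff.comp h1))).add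
      (h2.smul contDiff_const)

theorem exp_neg_mul_exp (A : Matrix n n ℂ) :
    NormedSpace.exp A * NormedSpace.exp (-A) = 1 := by
  rw [← Matrix.exp_add_of_commute _ _ (Commute.neg_right (Commute.refl A)), add_neg_cancel,
    NormedSpace.exp_zero]

theorem trace_star (M : Matrix n n ℂ) : (star M).trace = star M.trace :=
  Matrix.trace_conjTranspose M

/-- At the base point every factor equals 1, so varying `tᵢ` alone has velocity `g i * A * star (g
i)`; by hypothesis these span the traceless skew matrices. The extra factor supplies the Hermitian
directions and `i`, so the image is the full matrix space and no manifold structure on SU(n) is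
needed. -/
theorem surjective_fderiv_switchingMap [Nonempty n] {ι : Type} [Fintype ι] {A : Matrix n n ℂ}
    {g : ι → Matrix n n ℂ} (hg : ∀ i, g i ∈ Matrix.unitaryGroup n ℂ)
    (hspan : ∀ M : Matrix n n ℂ, star M = -M → M.trace = 0 →
      M ∈ Submodule.span ℝ (range fun i => g i * A * star (g i)))
    (m : Matrix n n ℂ) :
    ∃ e, fderiv ℝ (switchingMap A g) ((fun _ => 1, 0, 0), fun i => NormedSpace.exp (-A) * star (g i))
      (e, 0) = m := by
  classical
  set q₀ : ι → Matrix n n ℂ := fun i => NormedSpace.exp (-A) * star (g i) with hq₀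
  set e₀ : (ι → ℝ) × Matrix n n ℂ × ℝ := (fun _ => 1, 0, 0) with he₀
  set D := fderiv ℝ (switchingMap A g) (e₀, q₀) with hD
  have hd : HasFDerivAt (switchingMap A g) D (e₀, q₀) :=
    ((contDiff_switchingMap A g).differentiable one_ne_zero _).hasFDerivAt
  have hcurve : ∀ (e : (ι → ℝ) × Matrix n n ℂ × ℝ) (d : Matrix n n ℂ),
      HasDerivAt (fun s : ℝ => switchingMap A g (e₀ + s • e, q₀)) d 0 → D (e, 0) = d := by
    intro e d h
    have h1 : HasDerivAt (fun s : ℝ => (e₀ + s • e, q₀)) (e, (0 : ι → Matrix n n ℂ)) 0 := by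
      have h2 : HasDerivAt (fun s : ℝ => e₀ + s • e) e 0 := by
        simpa using ((hasDerivAt_id (0 : ℝ)).smul_const e).const_add e₀
      exact h2.prodMk (hasDerivAt_const _ _)
    exact (HasFDerivAt.comp_hasDerivAt_of_eq (0 : ℝ) hd h1 (by simp)).unique h
  let R : Submodule ℝ (Matrix n n ℂ) :=
    LinearMap.range (D.toLinearMap ∘ₗ LinearMap.inl ℝ _ (ι → Matrix n n ℂ))
  have hfac : ∀ i, g i * NormedSpace.exp ((1 : ℝ) • A) * q₀ i = 1 := by
    intro i
    rw [hq₀, one_smul, mul_assoc, ← mul_assoc (NormedSpace.exp A), exp_neg_mul_exp, one_mul,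
      Matrix.mem_unitaryGroup_iff.1 (hg i)]
  have hR1 : ∀ i, g i * A * star (g i) ∈ R := by
    intro i
    refine ⟨(Pi.single i 1, 0, 0), hcurve (Pi.single i 1, 0, 0) _ ?_⟩
    have h1 : (fun s : ℝ => switchingMap A g
        (e₀ + s • ((Pi.single i 1, 0, 0) : (ι → ℝ) × Matrix n n ℂ × ℝ), q₀)) =
        fun s => g i * NormedSpace.exp (s • A) * star (g i) := by
      funext s
      have h2 : switchingMap A g
          (e₀ + s • ((Pi.single i 1, 0, 0) : (ι → ℝ) × Matrix n n ℂ × ℝ), q₀) =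
          ((Finset.univ.toList : List ι).map fun j =>
            g j * NormedSpace.exp ((1 + s * (Pi.single i 1 : ι → ℝ) j) • A) * q₀ j).prod := by
        simp [switchingMap, he₀]
      rw [h2, list_prod_eq_of_eq_one (i := i) (Finset.nodup_toList _) (by simp)]
      · rw [Pi.single_eq_same, mul_one, add_comm, add_smul, one_smul,
          Matrix.exp_add_of_commute _ _ ((Commute.refl A).smul_left s), hq₀]
        simp only [mul_assoc]
        rw [← mul_assoc (NormedSpace.exp A), exp_neg_mul_exp, one_mul]
      · intro j hj
        rw [Pi.single_eq_of_ne hj, mul_zero, add_zero, hfac]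
    rw [h1]
    refine (((hasDerivAt_exp_smul_const (𝕂 := ℝ) A (0 : ℝ)).const_mul (g i)).mul_const
      (star (g i))).congr_deriv ?_
    simp
  have hcorr : ∀ (M : Matrix n n ℂ) (θ s : ℝ), switchingMap A g (e₀ + s • ((0, M, θ) :
      (ι → ℝ) × Matrix n n ℂ × ℝ), q₀) = 1 + s • ((M + star M) + θ • Complex.I • 1) := by
    intro M θ s
    have h2 : ((Finset.univ.toList : List ι).map fun j =>
        g j * NormedSpace.exp ((1 : ℝ) • A) * q₀ j).prod = 1 :=
      List.prod_eq_one fun x hx => by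
        obtain ⟨j, -, rfl⟩ := List.mem_map.1 hx
        exact hfac j
    have h3 : switchingMap A g (e₀ + s • ((0, M, θ) : (ι → ℝ) × Matrix n n ℂ × ℝ), q₀) =
        ((Finset.univ.toList : List ι).map fun j =>
          g j * NormedSpace.exp ((1 : ℝ) • A) * q₀ j).prod *
        (1 + (s • M + star (s • M)) + (s * θ) • Complex.I • (1 : Matrix n n ℂ)) := by
      simp [switchingMap, he₀]
    rw [h3, h2, one_mul, star_smul, star_trivial]
    module
  have hR2 : ∀ (M : Matrix n n ℂ) (θ : ℝ), (M + star M) + θ • Complex.I • 1 ∈ R := by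
    intro M θ
    refine ⟨(0, M, θ), hcurve (0, M, θ) _ ?_⟩
    simp only [hcorr]
    simpa using ((hasDerivAt_id (0 : ℝ)).smul_const
      ((M + star M) + θ • Complex.I • (1 : Matrix n n ℂ))).const_add 1
  have hR3 : ∀ M : Matrix n n ℂ, star M = -M → M.trace = 0 → M ∈ R := fun M h1 h2 => by
    refine (Submodule.span_le (p := R)).2 ?_ (hspan M h1 h2)
    rintro _ ⟨i, rfl⟩
    exact hR1 i
  suffices h : m ∈ R by
    obtain ⟨e, he⟩ := h
    exact ⟨e, he⟩
  have hN : ((Fintype.card n : ℕ) : ℂ) ≠ 0 := Nat.cast_ne_zero.2 Fintype.card_ne_zero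
  -- The imaginary scalar whose removal makes the skew part of `m` traceless.
  let θ : ℝ := m.trace.im / Fintype.card n
  have hk : (2⁻¹ : ℝ) • (m - star m) - θ • Complex.I • (1 : Matrix n n ℂ) ∈ R := by
    refine hR3 _ ?_ ?_
    · simp only [star_sub, star_smul, star_star, star_one, star_trivial, Complex.star_def,
        Complex.conj_I]
      module
    · rw [Matrix.trace_sub, Matrix.trace_smul, Matrix.trace_sub, trace_star, Matrix.trace_smul,
        Matrix.trace_smul, Matrix.trace_one]
      have h1 : m.trace - star m.trace = 2 * m.trace.im * Complex.I := by
        rw [Complex.star_def, Complex.sub_conj]; push_cast; ring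
      rw [h1]
      simp only [θ, Complex.real_smul, smul_eq_mul]
      push_cast
      field_simp
      ring
  have := R.add_mem hk (hR2 ((2⁻¹ : ℝ) • m) θ)
  convert this using 1
  rw [star_smul, star_trivial (2⁻¹ : ℝ)]
  module

theorem list_prod_mem_insert_one {ι : Type*} {S : Set (Matrix n n ℂ)}
    (hm : ∀ g ∈ S, ∀ h ∈ S, g * h ∈ S) (l : List ι) {f : ι → Matrix n n ℂ} (hf : ∀ i, f i ∈ S) :
    (l.map f).prod ∈ insert 1 S := by
  induction l with
  | nil => simp
  | cons i l ih =>
    rw [List.map_cons, List.prod_cons]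
    rcases ih with h | h
    · rw [h, mul_one]; exact Or.inr (hf i)
    · exact Or.inr (hm _ (hf i) _ h)

/-- If the conjugates of the drift by reachable matrices span the traceless skew-Hermitian
matrices, then all special unitary matrices close to `1` are reachable. -/
theorem eventually_mem_reachable [Nonempty n] {A B : Matrix n n ℂ} (hA : star A = -A)
    (hB : star B = -B) (hA0 : A.trace = 0) (hB0 : B.trace = 0)
    (hspan : ∀ M : Matrix n n ℂ, star M = -M → M.trace = 0 → M ∈ conjSpan (reachable A B) A) :
    ∀ᶠ V in 𝓝 (1 : Matrix n n ℂ), V ∈ Matrix.specialUnitaryGroup n ℂ →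
      V ∈ insert 1 (reachable A B) := by
  have hm : ∀ g ∈ reachable A B, ∀ h ∈ reachable A B, g * h ∈ reachable A B :=
    fun g hg h hh => mul_mem_reachable hA hB hh hg
  have hU := reachable_subset_unitary hA hB
  have hSU := reachable_subset hA hB hA0 hB0
  obtain ⟨s, hs, hspan'⟩ := (Submodule.fg_span_iff_fg_span_finset_subset (R := ℝ)
    ((fun g => g * A * star g) '' reachable A B)).1 (IsNoetherian.noetherian _)
  choose g₀ hg₀ hg₀' using fun i : s => hs i.2
  let e := s.equivFin
  let g : Fin s.card → Matrix n n ℂ := fun i => g₀ (e.symm i)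
  have hg : ∀ i, g i ∈ reachable A B := fun i => hg₀ _
  have hrange : range (fun i => g i * A * star (g i)) = s := by
    ext x
    constructor
    · rintro ⟨i, rfl⟩
      have := hg₀' (e.symm i)
      simp only at this
      simp only [g, this]
      exact (e.symm i).2
    · intro hx
      refine ⟨e ⟨x, hx⟩, ?_⟩
      simp only [g, Equiv.symm_apply_apply]
      exact hg₀' ⟨x, hx⟩
  have hsurj := surjective_fderiv_switchingMap (A := A) (fun i => hU (hg i)) fun M h1 h2 => by
    rw [hrange, ← hspan']
    exact hspan M h1 h2
  set q₀ : Fin s.card → Matrix n n ℂ := fun i => NormedSpace.exp (-A) * star (g i) with hq₀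
  set e₀ : (Fin s.card → ℝ) × Matrix n n ℂ × ℝ := (fun _ => 1, 0, 0) with he₀
  set D := fderiv ℝ (switchingMap A g) (e₀, q₀) with hD
  -- Keeping `q` as a second output makes the map open jointly, so one neighbourhood of 1 is covered
  -- for every `q` near `q₀`. This uniformity matters because `q₀` is only in the closure of the
  -- reachable tuples and must be replaced by a nearby reachable `q`.
  have hd : HasStrictFDerivAt (fun x => (switchingMap A g x, x.2))
      (D.prod (ContinuousLinearMap.snd ℝ _ _)) (e₀, q₀) :=
    ((contDiff_switchingMap A g).contDiffAt.hasStrictFDerivAt one_ne_zero).prodMk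
      hasStrictFDerivAt_snd
  have hopen := hd.map_nhds_eq_of_surj (LinearMap.range_eq_top.2 fun ⟨m, δ⟩ => by
    obtain ⟨e, he⟩ := hsurj (m - D (0, δ))
    refine ⟨(e, δ), Prod.ext ?_ rfl⟩
    have : ((e, δ) : ((Fin s.card → ℝ) × Matrix n n ℂ × ℝ) × (Fin s.card → Matrix n n ℂ)) =
        (e, 0) + (0, δ) := by simp
    change D (e, δ) = m
    rw [this, map_add, he, sub_add_cancel])
  have hval : switchingMap A g (e₀, q₀) = 1 := by
    have h1 : ((Finset.univ.toList : List (Fin s.card)).map fun i =>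
        g i * NormedSpace.exp (e₀.1 i • A) * q₀ i).prod = 1 :=
      List.prod_eq_one fun x hx => by
        obtain ⟨j, -, rfl⟩ := List.mem_map.1 hx
        simp only [he₀, hq₀]
        rw [one_smul, mul_assoc, ← mul_assoc (NormedSpace.exp A), exp_neg_mul_exp, one_mul,
          Matrix.mem_unitaryGroup_iff.1 (hU (hg j))]
    change _ * (1 + (e₀.2.1 + star e₀.2.1) + e₀.2.2 • Complex.I • (1 : Matrix n n ℂ)) = 1
    rw [h1]
    simp [he₀]
  simp only [hval] at hopen
  let Z : ((Fin s.card → ℝ) × Matrix n n ℂ × ℝ) × (Fin s.card → Matrix n n ℂ) → Matrix n n ℂ :=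
    fun x => 1 + (x.1.2.1 + star x.1.2.1) + x.1.2.2 • Complex.I • (1 : Matrix n n ℂ)
  have hZc : Continuous Z := by fun_prop
  have hZ1 : Z (e₀, q₀) = 1 := by simp [Z, he₀]
  have hgood : ∀ᶠ x in 𝓝 (e₀, q₀), (∀ i, 0 < x.1.1 i) ∧
      (Z x ∈ Matrix.specialUnitaryGroup n ℂ →
        (∃ θ : ℝ, Z x - star (Z x) = (2 * θ * Complex.I) • 1) → Z x = 1) := by
    refine (eventually_all.2 fun i => ?_).and ?_
    · have h1 : Continuous fun x : ((Fin s.card → ℝ) × Matrix n n ℂ × ℝ) ×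
          (Fin s.card → Matrix n n ℂ) => x.1.1 i := by fun_prop
      exact (h1.tendsto (e₀, q₀)).eventually_const_lt (by simp [he₀])
    · have h1 := hZc.tendsto (e₀, q₀)
      rw [hZ1] at h1
      exact h1.eventually eventually_eq_one
  have himg := image_mem_map (m := fun x => (switchingMap A g x, x.2)) hgood
  rw [hopen, nhds_prod_eq, mem_prod_iff] at himg
  obtain ⟨O, hO, O', hO', hsub⟩ := himg
  have hq₀c : q₀ ∈ closure (univ.pi fun _ : Fin s.card => reachable A B) := by
    rw [closure_pi_set]
    intro i _
    refine mul_mem_closure hm ?_ (star_mem_closure hm hU (subset_closure (hg i)))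
    simpa using exp_smul_drift_mem_closure hA hB (-1)
  obtain ⟨q, hqO, hq⟩ := mem_closure_iff_nhds.1 hq₀c O' hO'
  filter_upwards [hO] with V hV hVSU
  obtain ⟨x, ⟨hx1, hx2⟩, hx⟩ := hsub (mk_mem_prod hV hqO)
  obtain ⟨rfl, rfl⟩ := Prod.mk.inj hx
  set P := ((Finset.univ.toList : List (Fin s.card)).map fun i =>
      g i * NormedSpace.exp (x.1.1 i • A) * x.2 i).prod with hPdef
  have hPZ : switchingMap A g x = P * Z x := rfl
  have hP : P ∈ insert 1 (reachable A B) := list_prod_mem_insert_one hm _ fun i =>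
    hm _ (hm _ (hg i) _ (exp_smul_drift_mem_reachable A B (hx1 i))) _ (hq i (mem_univ i))
  have hPSU : P ∈ Matrix.specialUnitaryGroup n ℂ := by
    rcases hP with h | h
    · rw [h]; exact one_mem _
    · exact hSU h
  have hZSU : Z x ∈ Matrix.specialUnitaryGroup n ℂ := by
    have h1 : Z x = star P * switchingMap A g x := by
      rw [hPZ, ← mul_assoc, Matrix.mem_unitaryGroup_iff'.1
        (Matrix.mem_specialUnitaryGroup_iff.1 hPSU).1, one_mul]
    rw [h1]
    exact mul_mem (star ⟨P, hPSU⟩ : Matrix.specialUnitaryGroup n ℂ).2 hVSU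
  -- The correction factor is a quotient of special unitary matrices, and its skew part is scalar,
  -- so near 1 it is trivial.
  have hZx : Z x = 1 := hx2 hZSU ⟨x.1.2.2, by
    simp only [Z, star_add, star_smul, star_one, star_star, star_trivial, Complex.star_def,
      Complex.conj_I]
    module⟩
  rw [hPZ, hZx, mul_one]
  exact hP

end LocalSurjectivity

/-! ### Exponentials in SU(n) and the passage from local to global. -/

section Exponential

variable {n : Type*} [Fintype n] [DecidableEq n]

theorem exists_exp_I_smul_eq {V : Matrix n n ℂ} (hV : V ∈ Matrix.unitaryGroup n ℂ) :
    ∃ H : Matrix n n ℂ, IsSelfAdjoint H ∧ NormedSpace.exp (Complex.I • H) = V := by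
  have hnormal : IsStarNormal V :=
    ⟨(Matrix.mem_unitaryGroup_iff'.1 hV).trans (Matrix.mem_unitaryGroup_iff.1 hV).symm⟩
  -- The spectrum is finite, so the jump of `arg` does no harm.
  have hc : ∀ f : ℂ → ℂ, ContinuousOn f (spectrum ℂ V) := fun f =>
    (Matrix.finite_spectrum V).continuousOn f
  have hsa : IsSelfAdjoint (cfc (fun z => (z.arg : ℂ)) V) := IsSelfAdjoint.cfc_arg V
  refine ⟨cfc (fun z => (z.arg : ℂ)) V, hsa, ?_⟩
  have hI : Complex.I • cfc (fun z : ℂ => (z.arg : ℂ)) V =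
      cfc (fun z : ℂ => Complex.I • (z.arg : ℂ)) V := (cfc_smul _ _ V (hc _)).symm
  have hcomp : NormedSpace.exp (Complex.I • cfc (fun z : ℂ => (z.arg : ℂ)) V) =
      cfc (fun z : ℂ => NormedSpace.exp (Complex.I • (z.arg : ℂ))) V := by
    rw [hI, ← CFC.exp_eq_normedSpace_exp (𝕜 := ℂ) (cfc_predicate _ _)]
    exact (cfc_comp' (NormedSpace.exp : ℂ → ℂ) _ V
      (NormedSpace.exp_continuous.continuousOn) (hc _)).symm
  rw [hcomp]
  conv_rhs => rw [← cfc_id' ℂ V]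
  refine cfc_congr fun y hy => ?_
  have hy1 : ‖y‖ = 1 := spectrum.norm_eq_one_of_unitary hV hy
  have hlog : Complex.I • (y.arg : ℂ) = Complex.log y :=
    Complex.ext (by simp [Complex.log_re, hy1]) (by simp [Complex.log_im])
  have hy0 : y ≠ 0 := by rintro rfl; simp at hy1
  simp only [hlog, ← Complex.exp_eq_exp_ℂ, Complex.exp_log hy0]

theorem exp_unitary_conj_diagonal {U : Matrix n n ℂ} (hU : U ∈ Matrix.unitaryGroup n ℂ)
    (d : n → ℂ) : NormedSpace.exp (U * Matrix.diagonal d * star U) =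
      U * Matrix.diagonal (fun i => Complex.exp (d i)) * star U := by
  have h1 : U⁻¹ = star U := Matrix.inv_eq_right_inv (Matrix.mem_unitaryGroup_iff.1 hU)
  have h2 : IsUnit U := ⟨⟨U, star U, Matrix.mem_unitaryGroup_iff.1 hU,
    Matrix.mem_unitaryGroup_iff'.1 hU⟩, rfl⟩
  rw [← h1, Matrix.exp_conj _ _ h2, Matrix.exp_diagonal, Pi.exp_def, Complex.exp_eq_exp_ℂ]

/-- Every special unitary matrix is the exponential of a traceless skew-Hermitian one. -/
theorem exists_exp_eq [Nonempty n] {V : Matrix n n ℂ}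
    (hV : V ∈ Matrix.specialUnitaryGroup n ℂ) :
    ∃ K : Matrix n n ℂ, star K = -K ∧ K.trace = 0 ∧ NormedSpace.exp K = V := by
  obtain ⟨hVU, hdet⟩ := Matrix.mem_specialUnitaryGroup_iff.1 hV
  obtain ⟨H, hH, hHV⟩ := exists_exp_I_smul_eq hVU
  have hH' : H.IsHermitian := hH
  have hspec := hH'.spectral_theorem
  rw [Unitary.conjStarAlgAut_apply] at hspec
  set U : Matrix n n ℂ := hH'.eigenvectorUnitary.1
  have hU : U ∈ Matrix.unitaryGroup n ℂ := hH'.eigenvectorUnitary.2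
  set h : n → ℝ := hH'.eigenvalues
  have hIH : Complex.I • H =
      U * Matrix.diagonal (fun i => Complex.I * (h i : ℂ)) * star U := by
    conv_lhs => rw [hspec]
    rw [← smul_mul_assoc, ← mul_smul_comm, ← Matrix.diagonal_smul]
    rfl
  have hVd : V = U * Matrix.diagonal (fun i => Complex.exp (Complex.I * h i)) * star U := by
    rw [← hHV, hIH, exp_unitary_conj_diagonal hU]
  have hdet' : Complex.exp (∑ i, Complex.I * h i) = 1 := by
    rw [Complex.exp_sum, ← Matrix.det_diagonal, ← hdet, hVd, Matrix.det_mul, Matrix.det_mul,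
      mul_right_comm, ← Matrix.det_mul, Matrix.mem_unitaryGroup_iff.1 hU, Matrix.det_one, one_mul]
  obtain ⟨k, hk⟩ := Complex.exp_eq_one_iff.1 hdet'
  obtain ⟨i₀⟩ := ‹Nonempty n›
  -- The phases sum to a multiple of 2π; subtracting it from a single one makes the trace zero and
  -- leaves the exponential unchanged.
  let h' : n → ℝ := h - Pi.single i₀ (2 * Real.pi * k)
  have hsum : ∑ i, (h' i : ℂ) = 0 := by
    rw [← Finset.mul_sum] at hk
    have h1 : ∑ i, (h i : ℂ) = 2 * Real.pi * k :=
      mul_left_cancel₀ Complex.I_ne_zero (by rw [hk]; ring)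
    have h2 : ∑ i, h i = 2 * Real.pi * k := by exact_mod_cast h1
    have h3 : ∑ i, h' i = 0 := by simp [h', h2]
    exact_mod_cast h3
  have hexp : ∀ i, Complex.exp (Complex.I * h' i) = Complex.exp (Complex.I * h i) := by
    intro i
    by_cases hi : i = i₀
    · subst hi
      have : Complex.I * (h' i : ℂ) = Complex.I * h i - k * (2 * Real.pi * Complex.I) := by
        simp only [h', Pi.sub_apply, Pi.single_eq_same]
        push_cast; ring
      rw [this, Complex.exp_sub, Complex.exp_int_mul_two_pi_mul_I, div_one]
    · simp [h', hi]
  refine ⟨U * Matrix.diagonal (fun i => Complex.I * (h' i : ℂ)) * star U, ?_, ?_, ?_⟩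
  · have h1 : star (Matrix.diagonal fun i => Complex.I * (h' i : ℂ)) =
        -Matrix.diagonal fun i => Complex.I * (h' i : ℂ) := by
      rw [Matrix.star_eq_conjTranspose, Matrix.diagonal_conjTranspose, Matrix.diagonal_neg]
      congr 1
      funext i
      simp
    rw [star_mul, star_mul, star_star, h1, neg_mul, mul_neg, mul_assoc]
  · rw [Matrix.trace_mul_comm, ← mul_assoc, Matrix.mem_unitaryGroup_iff'.1 hU, one_mul,
      Matrix.trace_diagonal, ← Finset.mul_sum, hsum, mul_zero]
  · rw [exp_unitary_conj_diagonal hU, hVd]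
    simp only [hexp]

theorem exp_mem_specialUnitaryGroup {K : Matrix n n ℂ} (hK : star K = -K) (hK0 : K.trace = 0) :
    NormedSpace.exp K ∈ Matrix.specialUnitaryGroup n ℂ := by
  simpa using reachable_subset hK (B := 0) (by simp) hK0 (by simp)
    (exp_smul_drift_mem_reachable K 0 one_pos)

variable {A B : Matrix n n ℂ}

/-- If the smallest real subspace containing the drift and stable under commutators with the drift
and with the control contains all traceless skew-Hermitian matrices, then every special unitary
matrix is reachable from the identity. -/
theorem specialUnitaryGroup_subset_reachable [Nonempty n] (hA : star A = -A) (hB : star B = -B)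
    (hA0 : A.trace = 0) (hB0 : B.trace = 0)
    (hgen : ∀ W : Submodule ℝ (Matrix n n ℂ), A ∈ W → (∀ M ∈ W, A * M - M * A ∈ W) →
      (∀ M ∈ W, B * M - M * B ∈ W) → ∀ M, star M = -M → M.trace = 0 → M ∈ W) :
    (Matrix.specialUnitaryGroup n ℂ : Set (Matrix n n ℂ)) ⊆ reachable A B := by
  have hnear := eventually_mem_reachable hA hB hA0 hB0
    (hgen _ (drift_mem_conjSpan hA) (fun M => commutator_drift_mem_conjSpan hA hB)
      (fun M => commutator_control_mem_conjSpan hA hB))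
  have hm : ∀ g ∈ reachable A B, ∀ h ∈ reachable A B, g * h ∈ reachable A B :=
    fun g hg h hh => mul_mem_reachable hA hB hh hg
  have hm' : ∀ g ∈ insert 1 (reachable A B), ∀ h ∈ reachable A B, g * h ∈ reachable A B := by
    rintro g (rfl | hg) h hh
    · rwa [one_mul]
    · exact hm g hg h hh
  have hins : ∀ V ∈ Matrix.specialUnitaryGroup n ℂ, V ∈ insert 1 (reachable A B) := by
    intro V hV
    obtain ⟨K, hK, hK0, rfl⟩ := exists_exp_eq hV
    have hlim : Tendsto (fun k : ℕ => NormedSpace.exp (((k + 1 : ℕ) : ℝ)⁻¹ • K)) atTop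
        (𝓝 (1 : Matrix n n ℂ)) := by
      have h1 : Continuous fun s : ℝ => NormedSpace.exp (s • K) :=
        contDiff_exp_matrix.continuous.comp (continuous_id.smul continuous_const)
      have h2 := h1.tendsto 0
      rw [zero_smul, NormedSpace.exp_zero] at h2
      exact h2.comp
        ((tendsto_inv_atTop_nhds_zero_nat (𝕜 := ℝ)).comp (tendsto_add_atTop_nat 1))
    obtain ⟨k, hk⟩ := (hlim.eventually hnear).exists
    have hk1 := hk (exp_mem_specialUnitaryGroup (star_smul_skew hK _) (by simp [hK0]))
    have hpow : NormedSpace.exp K = NormedSpace.exp (((k + 1 : ℕ) : ℝ)⁻¹ • K) ^ (k + 1) := by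
      rw [← Matrix.exp_nsmul, ← Nat.cast_smul_eq_nsmul ℝ, smul_smul,
        mul_inv_cancel₀ (Nat.cast_ne_zero.2 k.succ_ne_zero), one_smul]
    rw [hpow]
    rcases hk1 with h | h
    · rw [h, one_pow]; exact Or.inl rfl
    · refine Or.inr ?_
      generalize NormedSpace.exp (((k + 1 : ℕ) : ℝ)⁻¹ • K) = g at h
      clear hpow hk
      induction k with
      | zero => simpa using h
      | succ j ih => rw [pow_succ]; exact hm _ ih _ h
  intro V hV
  have hE := exp_smul_drift_mem_reachable A B one_pos
  have hESU := reachable_subset hA hB hA0 hB0 hE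
  -- Writing `V = (V exp (-A)) exp A` absorbs the possible exception 1, since `exp A` is itself
  -- reached in positive time.
  have h1 : V * star (NormedSpace.exp ((1 : ℝ) • A)) ∈ Matrix.specialUnitaryGroup n ℂ :=
    mul_mem hV (star ⟨_, hESU⟩ : Matrix.specialUnitaryGroup n ℂ).2
  have h2 := hm' _ (hins _ h1) _ hE
  rwa [mul_assoc, Matrix.mem_unitaryGroup_iff'.1 (Matrix.mem_specialUnitaryGroup_iff.1 hESU).1,
    mul_one] at h2

end Exponential

end Analysis

/-! ### The Lie algebra generated by the Ising drift and the nonselective control. -/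

section SpinAlgebra

/-- The unnormalized Pauli matrices. -/
def sigma : Fin 4 → Matrix (Fin 2) (Fin 2) ℂ :=
  ![!![1, 0; 0, 1], !![0, 1; 1, 0], !![0, -Complex.I; Complex.I, 0], !![1, 0; 0, -1]]

/-- The skew-Hermitian product operators `i σⱼ ⊗ σₖ`. -/
def spin (j k : Fin 4) : Matrix (Fin 2 × Fin 2) (Fin 2 × Fin 2) ℂ :=
  Complex.I • (sigma j ⊗ₖ sigma k)

theorem smul_productOp (j k : Fin 4) (r : ℝ) :
    -Complex.I • (r : ℂ) • productOp j k = (-2⁻¹ * r) • spin j k := by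
  have h : ((Real.sqrt 2 : ℝ) : ℂ)⁻¹ * ((Real.sqrt 2 : ℝ) : ℂ)⁻¹ = 2⁻¹ := by
    rw [← mul_inv, ← Complex.ofReal_mul, Real.mul_self_sqrt zero_le_two]; norm_num
  have hp : ∀ i, pauli i = ((Real.sqrt 2 : ℝ) : ℂ)⁻¹ • sigma i := by
    intro i; fin_cases i <;> rfl
  rw [productOp, hp, hp, Matrix.smul_kronecker, Matrix.kronecker_smul, smul_smul _ _ (_ ⊗ₖ _), h,
    spin]
  match_scalars
  simp
  ring

theorem spin_mul_spin (j k l m : Fin 4) :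
    spin j k * spin l m = -((sigma j * sigma l) ⊗ₖ (sigma k * sigma m)) := by
  rw [spin, spin, smul_mul_smul_comm, Complex.I_mul_I, ← Matrix.mul_kronecker_mul, neg_one_smul]

theorem sigma_zero : sigma 0 = 1 := by
  ext i j; fin_cases i <;> fin_cases j <;> simp [sigma]

theorem sigma_one_mul_one : sigma 1 * sigma 1 = 1 := by
  ext i j; fin_cases i <;> fin_cases j <;> simp [sigma]

theorem sigma_one_mul_two : sigma 1 * sigma 2 = Complex.I • sigma 3 := by
  ext i j; fin_cases i <;> fin_cases j <;> simp [sigma]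

theorem sigma_two_mul_one : sigma 2 * sigma 1 = -Complex.I • sigma 3 := by
  ext i j; fin_cases i <;> fin_cases j <;> simp [sigma]

theorem sigma_two_mul_three : sigma 2 * sigma 3 = Complex.I • sigma 1 := by
  ext i j; fin_cases i <;> fin_cases j <;> simp [sigma]

theorem sigma_three_mul_two : sigma 3 * sigma 2 = -Complex.I • sigma 1 := by
  ext i j; fin_cases i <;> fin_cases j <;> simp [sigma]

theorem sigma_three_mul_one : sigma 3 * sigma 1 = Complex.I • sigma 2 := by
  ext i j; fin_cases i <;> fin_cases j <;> simp [sigma]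

theorem sigma_one_mul_three : sigma 1 * sigma 3 = -Complex.I • sigma 2 := by
  ext i j; fin_cases i <;> fin_cases j <;> simp [sigma]

/-- A subspace stable under two linear maps that act on sixteen vectors as the commutators with the
Ising drift and with the nonselective control act on the spin operators contains all of them but
the scalar one, if it contains the drift. -/
theorem mem_of_stable {V : Type*} [AddCommGroup V] [Module ℝ V] (W : Submodule ℝ V)
    (D E : V →ₗ[ℝ] V) (s : Fin 4 → Fin 4 → V) {a b c : ℝ} (ha : a ≠ 0) (hb : b ≠ 0) (hc : c ≠ 0)
    (hab : a ^ 2 - b ^ 2 ≠ 0)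
    (hE : E (s 0 1) = 0 ∧ E (s 1 0) = 0 ∧ E (s 0 2) = s 0 3 ∧ E (s 2 0) = s 3 0 ∧
      E (s 0 3) = -s 0 2 ∧ E (s 3 0) = -s 2 0 ∧ E (s 1 2) = s 1 3 ∧ E (s 2 1) = s 3 1 ∧
      E (s 1 3) = -s 1 2 ∧ E (s 3 1) = -s 2 1 ∧ E (s 2 2) = s 2 3 + s 3 2 ∧
      E (s 2 3) = s 3 3 - s 2 2 ∧ E (s 3 2) = s 3 3 - s 2 2 ∧ E (s 3 3) = -(s 3 2 + s 2 3))
    (hD : D (s 0 1) = a • s 0 2 + c • s 3 2 ∧ D (s 1 0) = b • s 2 0 + c • s 2 3 ∧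
      D (s 0 2) = -(a • s 0 1 + c • s 3 1) ∧ D (s 2 0) = -(b • s 1 0 + c • s 1 3) ∧
      D (s 2 1) = a • s 2 2 - b • s 1 1 ∧ D (s 2 2) = -(a • s 2 1 + b • s 1 2))
    (hWD : ∀ v ∈ W, D v ∈ W) (hWE : ∀ v ∈ W, E v ∈ W)
    (h0 : a • s 0 3 + b • s 3 0 + c • s 3 3 ∈ W) :
    ∀ j k, (j, k) ≠ (0, 0) → s j k ∈ W := by
  obtain ⟨E01, E10, E02, E20, E03, E30, E12, E21, E13, E31, E22, E23, E32, E33⟩ := hE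
  obtain ⟨D01, D10, D02, D20, D21, D22⟩ := hD
  have key : ∀ {r : ℝ} {x y : V}, r ≠ 0 → y ∈ W → r • x = y → x ∈ W :=
    fun hr hy e => (W.smul_mem_iff hr).1 (e ▸ hy)
  have v1 := hWE _ h0
  have v2 := hWE _ v1
  have v3 := hWE _ v2
  simp only [map_add, map_sub, map_neg, map_smul, E02, E20, E03, E30, E22, E23, E32, E33]
    at v1 v2 v3
  -- `E²` is -1 on the one-spin part of `v1` and -4 on its coupling part, so `v1 + v3` isolates the
  -- coupling.
  have hp : s 3 2 + s 2 3 ∈ W :=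
    key (mul_ne_zero three_ne_zero hc) (W.add_mem v1 v3) (by module)
  have hp' := hWE _ hp
  simp only [map_add, E23, E32] at hp'
  have hz : a • s 0 3 + b • s 3 0 ∈ W := by
    have := W.add_mem v2 (W.smul_mem c hp')
    exact key (neg_ne_zero.2 one_ne_zero) this (by module)
  have h33 : s 3 3 ∈ W := key hc (W.sub_mem h0 hz) (by module)
  have h22 : s 2 2 ∈ W := key two_ne_zero (W.sub_mem (W.smul_mem 2 h33) hp') (by module)
  have hy := hWE _ hz
  simp only [map_add, map_smul, E03, E30] at hy
  have w1 := hWD _ hy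
  have w2 := hWE _ (hWD _ h22)
  simp only [map_add, map_neg, map_smul, D02, D20, D22, E21, E12] at w1 w2
  -- `w2` cancels the two-spin terms `s 3 1`, `s 1 3` of `w1`. Each such round raises the powers of
  -- `a` and `b` in the one-spin combination.
  have hx : a ^ 2 • s 0 1 + b ^ 2 • s 1 0 ∈ W :=
    key one_ne_zero (W.add_mem w1 (W.smul_mem c w2)) (by module)
  have hx1 := hWD _ hx
  have hx2 := hWE _ hx1
  simp only [map_add, map_smul, D01, D10, E02, E20, E23, E32] at hx1 hx2
  have hz3 : a ^ 3 • s 0 3 + b ^ 3 • s 3 0 ∈ W := by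
    have := W.sub_mem hx2 (W.smul_mem (c * (a ^ 2 + b ^ 2)) (W.sub_mem h33 h22))
    exact key one_ne_zero this (by module)
  -- With `hz` this is a 2 by 2 Vandermonde-type system in `s 0 3` and `s 3 0`; solving it requires
  -- `a² ≠ b²`.
  have h03 : s 0 3 ∈ W :=
    key (mul_ne_zero ha hab) (W.sub_mem hz3 (W.smul_mem (b ^ 2) hz)) (by module)
  have h30 : s 3 0 ∈ W := key hb (W.sub_mem hz (W.smul_mem a h03)) (by module)
  have h02 : s 0 2 ∈ W := key (neg_ne_zero.2 one_ne_zero) (hWE _ h03) (by rw [E03]; module)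
  have h20 : s 2 0 ∈ W := key (neg_ne_zero.2 one_ne_zero) (hWE _ h30) (by rw [E30]; module)
  have h32 : s 3 2 ∈ W := by
    have := W.sub_mem (W.sub_mem hx1 (W.add_mem (W.smul_mem (a ^ 3) h02) (W.smul_mem (b ^ 3) h20)))
      (W.smul_mem (c * b ^ 2) hp)
    exact key (mul_ne_zero hc hab) this (by module)
  have h23 : s 2 3 ∈ W := key one_ne_zero (W.sub_mem hp h32) (by module)
  have x1 := hWD _ h02
  have x2 := hWE _ x1
  have x3 := hWD _ h20
  have x4 := hWE _ x3
  simp only [map_add, map_neg, map_smul, D02, D20, E01, E10, E31, E13] at x1 x2 x3 x4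
  have h21 : s 2 1 ∈ W := key hc x2 (by module)
  have h12 : s 1 2 ∈ W := key hc x4 (by module)
  have h31 : s 3 1 ∈ W := E21 ▸ hWE _ h21
  have h13 : s 1 3 ∈ W := E12 ▸ hWE _ h12
  have h01 : s 0 1 ∈ W :=
    key (neg_ne_zero.2 ha) (W.add_mem x1 (W.smul_mem c h31)) (by module)
  have h10 : s 1 0 ∈ W :=
    key (neg_ne_zero.2 hb) (W.add_mem x3 (W.smul_mem c h13)) (by module)
  have h11 : s 1 1 ∈ W :=
    key (neg_ne_zero.2 hb) (W.sub_mem (hWD _ h21) (W.smul_mem a h22)) (by rw [D21]; module)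
  intro j k hjk
  fin_cases j <;> fin_cases k <;> first | assumption | exact absurd rfl hjk

theorem spin_commutator_control 
    (E : Matrix (Fin 2 × Fin 2) (Fin 2 × Fin 2) ℂ → Matrix (Fin 2 × Fin 2) (Fin 2 × Fin 2) ℂ)
    (hE : ∀ Q, E Q = (-2⁻¹ : ℝ) • ((spin 0 1 + spin 1 0) * Q - Q * (spin 0 1 + spin 1 0))) :
    E (spin 0 1) = 0 ∧ E (spin 1 0) = 0 ∧ E (spin 0 2) = spin 0 3 ∧ E (spin 2 0) = spin 3 0 ∧
      E (spin 0 3) = -spin 0 2 ∧ E (spin 3 0) = -spin 2 0 ∧ E (spin 1 2) = spin 1 3 ∧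
      E (spin 2 1) = spin 3 1 ∧ E (spin 1 3) = -spin 1 2 ∧ E (spin 3 1) = -spin 2 1 ∧
      E (spin 2 2) = spin 2 3 + spin 3 2 ∧ E (spin 2 3) = spin 3 3 - spin 2 2 ∧
      E (spin 3 2) = spin 3 3 - spin 2 2 ∧ E (spin 3 3) = -(spin 3 2 + spin 2 3) := by
  refine ⟨?_, ?_, ?_, ?_, ?_, ?_, ?_, ?_, ?_, ?_, ?_, ?_, ?_, ?_⟩ <;>
  · simp only [hE, add_mul, mul_add, spin_mul_spin, sigma_zero, one_mul, mul_one,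
      sigma_one_mul_one, sigma_one_mul_two, sigma_two_mul_one, sigma_three_mul_one,
      sigma_one_mul_three, Matrix.smul_kronecker, Matrix.kronecker_smul]
    try simp only [spin, sigma_zero]
    match_scalars <;> simp <;> ring_nf

theorem spin_commutator_drift (a b c : ℝ)
    (D : Matrix (Fin 2 × Fin 2) (Fin 2 × Fin 2) ℂ → Matrix (Fin 2 × Fin 2) (Fin 2 × Fin 2) ℂ)
    (hD : ∀ Q, D Q = (-2⁻¹ : ℝ) • ((a • spin 0 3 + b • spin 3 0 + c • spin 3 3) * Q -
      Q * (a • spin 0 3 + b • spin 3 0 + c • spin 3 3))) :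
    D (spin 0 1) = a • spin 0 2 + c • spin 3 2 ∧ D (spin 1 0) = b • spin 2 0 + c • spin 2 3 ∧
      D (spin 0 2) = -(a • spin 0 1 + c • spin 3 1) ∧
      D (spin 2 0) = -(b • spin 1 0 + c • spin 1 3) ∧
      D (spin 2 1) = a • spin 2 2 - b • spin 1 1 ∧
      D (spin 2 2) = -(a • spin 2 1 + b • spin 1 2) := by
  refine ⟨?_, ?_, ?_, ?_, ?_, ?_⟩ <;>
  · simp only [hD, add_mul, mul_add, smul_mul_assoc, mul_smul_comm, spin_mul_spin, sigma_zero,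
      one_mul, mul_one, sigma_two_mul_three, sigma_three_mul_two, sigma_three_mul_one,
      sigma_one_mul_three, Matrix.smul_kronecker, Matrix.kronecker_smul]
    try simp only [spin, sigma_zero]
    match_scalars <;> simp <;> ring_nf

theorem star_spin (j k : Fin 4) : star (spin j k) = -spin j k := by
  have h : ∀ i, (sigma i)ᴴ = sigma i := by
    intro i
    fin_cases i <;> ext x y <;> fin_cases x <;> fin_cases y <;>
      simp [sigma, Matrix.conjTranspose_apply]
  rw [Matrix.star_eq_conjTranspose, spin, Matrix.conjTranspose_smul,
    Matrix.conjTranspose_kronecker, h, h, Complex.star_def, Complex.conj_I, neg_smul]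

theorem trace_spin {j k : Fin 4} (h : (j, k) ≠ (0, 0)) : (spin j k).trace = 0 := by
  have hs : ∀ i, i ≠ 0 → (sigma i).trace = 0 := by
    intro i hi
    fin_cases i <;> simp [sigma, Matrix.trace_fin_two] at hi ⊢
  rw [spin, Matrix.trace_smul, Matrix.trace_kronecker]
  by_cases hj : j = 0
  · rw [hs k (fun hk => h (by rw [hj, hk])), mul_zero, smul_zero]
  · rw [hs j hj, zero_mul, smul_zero]

theorem eq_sum_sigma (A : Matrix (Fin 2) (Fin 2) ℂ) :
    A = ((A 0 0 + A 1 1) / 2) • sigma 0 + ((A 0 1 + A 1 0) / 2) • sigma 1 +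
      (Complex.I * (A 0 1 - A 1 0) / 2) • sigma 2 + ((A 0 0 - A 1 1) / 2) • sigma 3 := by
  ext x y
  fin_cases x <;> fin_cases y <;> simp [sigma] <;> ring_nf <;> (simp; ring)

/-- A matrix unit of the product is a Kronecker product of 2 by 2 matrix units, each of which
expands in Pauli matrices. -/
theorem exists_eq_sum_sigma_kronecker (M : Matrix (Fin 2 × Fin 2) (Fin 2 × Fin 2) ℂ) :
    ∃ z : Fin 4 × Fin 4 → ℂ, ∑ p, z p • (sigma p.1 ⊗ₖ sigma p.2) = M := by
  rw [← Submodule.mem_span_range_iff_exists_fun]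
  set S := Submodule.span ℂ (Set.range fun p : Fin 4 × Fin 4 => sigma p.1 ⊗ₖ sigma p.2)
  have hS : ∀ j k, sigma j ⊗ₖ sigma k ∈ S := fun j k => Submodule.subset_span ⟨(j, k), rfl⟩
  have hS' : ∀ A B : Matrix (Fin 2) (Fin 2) ℂ, A ⊗ₖ B ∈ S := by
    intro A B
    rw [eq_sum_sigma A, eq_sum_sigma B]
    simp only [Matrix.add_kronecker, Matrix.kronecker_add, Matrix.smul_kronecker,
      Matrix.kronecker_smul]
    repeat' first | apply S.add_mem | apply S.smul_mem
    all_goals exact hS _ _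
  rw [Matrix.matrix_eq_sum_single M]
  refine S.sum_mem fun x _ => S.sum_mem fun y _ => ?_
  have h := Matrix.single_kronecker_single x.1 y.1 x.2 y.2 (M x y) (1 : ℂ)
  rw [mul_one] at h
  rw [← Prod.mk.eta (p := x), ← Prod.mk.eta (p := y), ← h]
  exact hS' _ _

/-- Traceless skew-Hermitian matrices are real combinations of the nonscalar spin operators. -/
theorem mem_of_spin_mem {W : Submodule ℝ (Matrix (Fin 2 × Fin 2) (Fin 2 × Fin 2) ℂ)}
    (hW : ∀ j k, (j, k) ≠ (0, 0) → spin j k ∈ W) {M : Matrix (Fin 2 × Fin 2) (Fin 2 × Fin 2) ℂ}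
    (hM : star M = -M) (hM0 : M.trace = 0) : M ∈ W := by
  obtain ⟨z, rfl⟩ := exists_eq_sum_sigma_kronecker M
  have h1 : ∀ w : ℂ, ∀ j k, w • (sigma j ⊗ₖ sigma k) = (-Complex.I * w) • spin j k := by
    intro w j k
    rw [spin, smul_smul]
    congr 1
    linear_combination w * Complex.I_sq
  have h2 : ∑ p : Fin 4 × Fin 4, z p • (sigma p.1 ⊗ₖ sigma p.2) =
      ∑ p : Fin 4 × Fin 4, (z p).im • spin p.1 p.2 := by
    set M := ∑ p : Fin 4 × Fin 4, z p • (sigma p.1 ⊗ₖ sigma p.2) with hMdef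
    -- Averaging `M` with `-M*` makes each coefficient of `spin` real without invoking linear
    -- independence.
    have h3 : M = (2⁻¹ : ℂ) • (M - star M) := by
      rw [hM, sub_neg_eq_add, ← two_smul ℂ M, smul_smul]; norm_num
    rw [h3, hMdef, star_sum, ← Finset.sum_sub_distrib, Finset.smul_sum]
    refine Finset.sum_congr rfl fun p _ => ?_
    rw [h1, star_smul, star_spin, ← Complex.coe_smul (z p).im]
    rw [smul_neg, sub_neg_eq_add, ← add_smul, smul_smul]
    congr 1
    apply Complex.ext <;> simp <;> ring
  rw [h2] at hM0 ⊢
  have h00 : (z (0, 0)).im = 0 := by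
    rw [Matrix.trace_sum, Finset.sum_eq_single (0, 0)] at hM0
    · simpa [spin, sigma_zero, Matrix.trace_smul] using hM0
    · intro p _ hp
      rw [Matrix.trace_smul, trace_spin hp, smul_zero]
    · simp
  refine W.sum_mem fun p _ => ?_
  by_cases hp : p = (0, 0)
  · rw [hp, h00, zero_smul]; exact W.zero_mem
  · exact W.smul_mem _ (hW _ _ hp)

end SpinAlgebra

/-! ### From reachability of SU(n) to operator and density control. -/

section Controllable

open scoped Matrix.Norms.L2Operator

variable {n : Type*} [Fintype n] [DecidableEq n]

theorem hasDerivWithinAt_entry {X : ℝ → Matrix n n ℂ} {X' : Matrix n n ℂ} {s : Set ℝ} {t : ℝ}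
    (h : HasDerivWithinAt X X' s t) (i j : n) : HasDerivWithinAt (fun r => X r i j) (X' i j) s t :=
  (Matrix.entryLinearMap ℝ ℂ i j).toContinuousLinearMap.hasFDerivAt.comp_hasDerivWithinAt t h

theorem generator_eq (H₀ H₁ : Matrix n n ℂ) (r : ℝ) :
    -Complex.I • H₀ + r • -Complex.I • H₁ = -Complex.I • (H₀ + (r : ℂ) • H₁) := by
  rw [smul_add, smul_comm r, Complex.coe_smul]

theorem operatorControllable_of_subset_reachable {H₀ H₁ : Matrix n n ℂ}
    (h : (Matrix.specialUnitaryGroup n ℂ : Set (Matrix n n ℂ)) ⊆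
      reachable (-Complex.I • H₀) (-Complex.I • H₁)) : OperatorControllable H₀ H₁ := by
  intro U hU V hV
  have hVU : V * star U ∈ Matrix.specialUnitaryGroup n ℂ :=
    mul_mem hV (star ⟨U, hU⟩ : Matrix.specialUnitaryGroup n ℂ).2
  obtain ⟨T, u, X, hT, hu, -, -, hX, hX0, hXT⟩ := h hVU
  refine ⟨T, u, fun t => X t * U, hT, hu, fun t ht i j => ?_, by simp only [hX0, one_mul], ?_⟩
  · rw [← smul_mul_assoc, ← generator_eq]
    exact hasDerivWithinAt_entry (hX.mul_const U t ht) i j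
  · simp only [hXT]
    rw [mul_assoc, Matrix.mem_unitaryGroup_iff'.1 (Matrix.mem_specialUnitaryGroup_iff.1 hU).1,
      mul_one]

/-- Every unitary matrix is special unitary up to a phase. -/
theorem exists_smul_mem_specialUnitaryGroup [Nonempty n] {W : Matrix n n ℂ}
    (hW : W ∈ Matrix.unitaryGroup n ℂ) :
    ∃ c : ℂ, c * star c = 1 ∧ c • W ∈ Matrix.specialUnitaryGroup n ℂ := by
  obtain ⟨c, hc⟩ := IsAlgClosed.exists_pow_nat_eq (W.det⁻¹) (Fintype.card_pos (α := n))
  have hdet : W.det * star W.det = 1 := by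
    rw [← Matrix.det_conjTranspose, ← Matrix.det_mul, ← Matrix.star_eq_conjTranspose,
      Matrix.mem_unitaryGroup_iff.1 hW, Matrix.det_one]
  have hdet0 : W.det ≠ 0 := left_ne_zero_of_mul_eq_one hdet
  have hnorm : ‖W.det‖ = 1 := by
    have := congrArg norm hdet
    rw [norm_mul, norm_star, norm_one] at this
    nlinarith [norm_nonneg W.det]
  have hc1 : ‖c‖ = 1 := by
    refine (pow_eq_one_iff_of_nonneg (norm_nonneg c) (Fintype.card_ne_zero (α := n))).1 ?_
    rw [← norm_pow, hc, norm_inv, hnorm, inv_one]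
  have hcc : c * star c = 1 := by
    rw [Complex.star_def, Complex.mul_conj, Complex.normSq_eq_norm_sq, hc1]; simp
  refine ⟨c, hcc, Matrix.mem_specialUnitaryGroup_iff.2 ⟨?_, ?_⟩⟩
  · rw [Matrix.mem_unitaryGroup_iff, star_smul, smul_mul_smul_comm, hcc,
      Matrix.mem_unitaryGroup_iff.1 hW, one_smul]
  · rw [Matrix.det_smul, hc, inv_mul_cancel₀ hdet0]

/-- The solution is `X ρ₀ X*`. Conjugation ignores phases, so `W` may be rescaled into SU(n). -/
theorem densityControllable_of_subset_reachable [Nonempty n] {H₀ H₁ : Matrix n n ℂ}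
    (h₀ : H₀.IsHermitian) (h₁ : H₁.IsHermitian)
    (h : (Matrix.specialUnitaryGroup n ℂ : Set (Matrix n n ℂ)) ⊆
      reachable (-Complex.I • H₀) (-Complex.I • H₁)) : DensityControllable H₀ H₁ := by
  rintro ρ₀ ρ₁ - - ⟨W, hW, rfl⟩
  obtain ⟨c, hc, hcW⟩ := exists_smul_mem_specialUnitaryGroup hW
  obtain ⟨T, u, X, hT, hu, -, -, hX, hX0, hXT⟩ := h hcW
  refine ⟨T, u, fun t => X t * ρ₀ * star (X t), hT, hu, fun t ht i j => ?_, ?_, ?_⟩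
  · refine hasDerivWithinAt_entry (X := fun t => X t * ρ₀ * star (X t)) ?_ i j
    refine (((hX t ht).mul_const ρ₀).mul (hX t ht).star).congr_deriv ?_
    have hH : star (H₀ + (u t : ℂ) • H₁) = H₀ + (u t : ℂ) • H₁ := by
      rw [star_add, star_smul, Matrix.star_eq_conjTranspose, Matrix.star_eq_conjTranspose, h₀.eq,
        h₁.eq, Complex.star_def, Complex.conj_ofReal]
    beta_reduce
    rw [generator_eq, star_mul, star_smul, hH, star_neg, Complex.star_def, Complex.conj_I, neg_neg,
      smul_sub, smul_mul_assoc, smul_mul_assoc, smul_mul_assoc, mul_smul_comm, mul_smul_comm,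
      neg_smul _ (X t * ρ₀ * star (X t) * _), sub_neg_eq_add]
    simp only [mul_assoc]
  · simp only [hX0, one_mul, star_one, mul_one]
  · simp only [hXT]
    rw [star_smul, smul_mul_assoc, smul_mul_smul_comm, hc, one_smul, Matrix.star_eq_conjTranspose]

end Controllable

/-! ### Application to the Ising system. -/

section Ising

open scoped Matrix.Norms.L2Operator

variable (h03 h30 h33 : ℝ)

theorem neg_I_smul_isingHamiltonian : -Complex.I • isingHamiltonian h03 h30 h33 =
    (-2⁻¹ : ℝ) • (h03 • spin 0 3 + h30 • spin 3 0 + h33 • spin 3 3) := by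
  rw [isingHamiltonian, smul_add, smul_add, smul_productOp, smul_productOp, smul_productOp]
  module

theorem neg_I_smul_nonselectiveHamiltonian : -Complex.I • nonselectiveHamiltonian =
    (-2⁻¹ : ℝ) • (spin 0 1 + spin 1 0) := by
  have h := fun j k => smul_productOp j k 1
  simp only [Complex.ofReal_one, one_smul, mul_one] at h
  rw [nonselectiveHamiltonian, smul_add, h, h, smul_add]

theorem star_drift : star (-Complex.I • isingHamiltonian h03 h30 h33) =
    -(-Complex.I • isingHamiltonian h03 h30 h33) := by
  rw [neg_I_smul_isingHamiltonian]
  simp only [star_smul, star_add, star_spin, star_trivial]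
  module

theorem star_nonselective : star (-Complex.I • nonselectiveHamiltonian) =
    -(-Complex.I • nonselectiveHamiltonian) := by
  rw [neg_I_smul_nonselectiveHamiltonian]
  simp only [star_smul, star_add, star_spin, star_trivial]
  module

theorem isHermitian_of_star_neg_I_smul {n : Type*} {H : Matrix n n ℂ}
    (h : star (-Complex.I • H) = -(-Complex.I • H)) : H.IsHermitian := by
  rw [star_smul, star_neg, Complex.star_def, Complex.conj_I, neg_neg, neg_smul, neg_neg] at h
  exact smul_right_injective _ Complex.I_ne_zero h

variable {h03 h30 h33}

theorem specialUnitaryGroup_subset_reachable_ising (ha : h03 ≠ 0) (hb : h30 ≠ 0) (hc : h33 ≠ 0)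
    (hab : h03 ^ 2 - h30 ^ 2 ≠ 0) :
    (Matrix.specialUnitaryGroup (Fin 2 × Fin 2) ℂ : Set (Matrix (Fin 2 × Fin 2) (Fin 2 × Fin 2) ℂ))
      ⊆ reachable (-Complex.I • isingHamiltonian h03 h30 h33)
        (-Complex.I • nonselectiveHamiltonian) := by
  refine specialUnitaryGroup_subset_reachable (star_drift _ _ _) star_nonselective ?_ ?_ ?_
  · rw [neg_I_smul_isingHamiltonian]
    simp [trace_spin]
  · rw [neg_I_smul_nonselectiveHamiltonian]
    simp [trace_spin]
  · intro W hA hWA hWB M hM hM0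
    rw [neg_I_smul_isingHamiltonian] at hA hWA
    rw [neg_I_smul_nonselectiveHamiltonian] at hWB
    refine mem_of_spin_mem (mem_of_stable W
      (LinearMap.mulLeft ℝ ((-2⁻¹ : ℝ) • (h03 • spin 0 3 + h30 • spin 3 0 + h33 • spin 3 3)) -
        LinearMap.mulRight ℝ ((-2⁻¹ : ℝ) • (h03 • spin 0 3 + h30 • spin 3 0 + h33 • spin 3 3)))
      (LinearMap.mulLeft ℝ ((-2⁻¹ : ℝ) • (spin 0 1 + spin 1 0)) -
        LinearMap.mulRight ℝ ((-2⁻¹ : ℝ) • (spin 0 1 + spin 1 0)))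
      spin ha hb hc hab (spin_commutator_control _ fun Q => ?_)
      (spin_commutator_drift _ _ _ _ fun Q => ?_) hWA hWB
      ((W.smul_mem_iff (by norm_num)).1 hA)) hM hM0
    · simp only [LinearMap.sub_apply, LinearMap.mulLeft_apply, LinearMap.mulRight_apply]
      rw [smul_mul_assoc, mul_smul_comm, smul_sub]
    · simp only [LinearMap.sub_apply, LinearMap.mulLeft_apply, LinearMap.mulRight_apply]
      rw [smul_mul_assoc, mul_smul_comm, smul_sub]

end Ising

end SpinControl

end

theorem mainTheorem6 (h03 h30 h33 : ℝ)
    (hf03 : h03 ≠ 0) (hf30 : h30 ≠ 0) (hsum : h03 ≠ -h30)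
    (hdiff : h03 ≠ h30) (hJ : h33 ≠ 0)
    (hplus : h33 ≠ (h03 - h30) / 2) (hminus : h33 ≠ -((h03 - h30) / 2)) :
    SpinControl.OperatorControllable (SpinControl.isingHamiltonian h03 h30 h33)
        SpinControl.nonselectiveHamiltonian ∧
      SpinControl.DensityControllable (SpinControl.isingHamiltonian h03 h30 h33)
        SpinControl.nonselectiveHamiltonian := by
  have hab : h03 ^ 2 - h30 ^ 2 ≠ 0 := by
    rw [sq_sub_sq]
    exact mul_ne_zero (fun h => hsum (eq_neg_of_add_eq_zero_left h)) (sub_ne_zero.2 hdiff)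
  have h := SpinControl.specialUnitaryGroup_subset_reachable_ising hf03 hf30 hJ hab
  exact ⟨SpinControl.operatorControllable_of_subset_reachable h,
    SpinControl.densityControllable_of_subset_reachable
      (SpinControl.isHermitian_of_star_neg_I_smul (SpinControl.star_drift _ _ _))
      (SpinControl.isHermitian_of_star_neg_I_smul SpinControl.star_nonselective) h⟩
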